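/- Let $n\ge 1$ and $k\ge 0$ be integers, let $K$ be a field of characteristic $0$ and let $q\in K$ be transcendental over $\mathbb{Q}$ (for instance $K=\mathbb{Q}(q)$). Let $V(z)=\bigl(\bigoplus_{m=1}^n K v_m\bigr)\otimes K[z,z^{-1}]$, with basis $(u_l)_{l\in\mathbb{Z}}$, $u_{m-nr}=z^r v_m$. The affine Hecke algebra $\widehat H_N(q^{-2})$ acts from the right on $V(z)^{\otimes N}$: $y_i$ acts as $z_i^{-1}$, i.e. as $u_l\mapsto u_{l+n}$ in the $i$-th factor, and, writing $v_{\mathbf m}z^{\mathbf r}=z^{r_1}v_{m_1}\otimes\cdots\otimes z^{r_N}v_{m_N}$, $$ (v_{\mathbf m} z^{\mathbf r})T_i=\begin{cases} -q^{-1}v_{\mathbf m\sigma_i}\sigma_i(z^{\mathbf r})+(q^{-2}-1)v_{\mathbf m}\,\partial_i(z_iz^{\mathbf r}) & m_i<m_{i+1},\\ -v_{\mathbf m}\sigma_i(z^{\mathbf r})+(q^{-2}-1)v_{\mathbf m}\,z_i\partial_i(z^{\mathbf r}) & m_i=m_{i+1},\\ -q^{-1}v_{\mathbf m\sigma_i}\sigma_i(z^{\mathbf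 r})+(q^{-2}-1)v_{\mathbf m}\,z_i\partial_i(z^{\mathbf r}) & m_i>m_{i+1}, \end{cases} $$ where $\sigma_i$ exchanges the $i$-th and $(i+1)$-st entries (or variables) and $\partial_i f=(f-\sigma_i f)/(z_i-z_{i+1})$. Let $A^{(N)}=\sum_{\sigma\in\mathfrak S_N}T_\sigma$ and $\bigwedge_q^N V(z)=V(z)^{\otimes N}/\ker A^{(N)}$, and let the $q$-wedge Fock space $\mathcal F_q$ be the inductive limit of the spaces $\bigwedge_q^N V(z)$ along the maps $w\mapsto w\wedge_q u_{-N}$. For a partition $\lambda$ put $|\lambda\rangle=u_{\lambda_1}\wedge_q u_{\lambda_2-1}\wedge_q u_{\lambda_3-2}\wedge_q\cdots\in\mathcal F_q$. Draw diagrams in the French convention. An $n$-ribbon is a connected skew shape with $n$ cells that contains no $2\times 2$ square; its initial cell is its rightmost and bottommost cell, its height is the number of rows that it meets, and its spin is (height $-1$)/2. For partitions $\alpha\subseteq\beta$ let $\mathrm{Tab}_n(\beta/\alpha,(k))$ be the set of tilings $T$ of $\beta/\alpha$ by $k$ $n$-ribbons each of whose initial cells is the bottom cell of $\beta/\alpha$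 in its column (horizontal $n$-ribbon strips of weight $k$). The spin $s(T)$ of a tiling is the sum of the spins of its ribbons, and $T'$ denotes the conjugate tiling, obtained from $T$ by exchanging rows and columns. **Lemma.** There are unique linear operators $\tilde U_k=e_k(y_1^{-1},y_2^{-1},\ldots)$ and $\tilde V_k=e_k(y_1,y_2,\ldots)$ on $\mathcal F_q$ that are the limits of the operators $e_k(y_1^{-1},\ldots,y_N^{-1})$ and $e_k(y_1,\ldots,y_N)$, in the following sense: for all $N$ and all $w\in V(z)^{\otimes N}$, the operator on $\mathcal F_q$ maps the class of $w$ to the class of the image of $w\otimes u_{-N}\otimes\cdots\otimes u_{-M+1}$ under the corresponding operator on $V(z)^{\otimes M}$, for all sufficiently large $M$. For every partition $\lambda$ they satisfy $$ \tilde U_k|\lambda\rangle=\sum_\nu\Bigl(\sum_{T\in\mathrm{Tab}_n(\lambda'/\nu',(k))}(-q)^{-2s(T')}\Bigr)|\nu\rangle,\qquad \tilde V_k|\lambda\rangle=\sum_\mu\Bigl(\sum_{T\in\mathrm{Tab}_n(\mu'/\lambda',(k))}(-q)^{-2s(T')}\Bigr)|\mu\rangle , $$ where each sum over partitions has only finitely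 many nonzero coefficients. Here $T'$ is a tiling of $\lambda/\nu$, respectively of $\mu/\lambda$. -/

import Mathlib

noncomputable section

namespace QFock

/-! ### The tensor powers of `V(z)` and the action of the affine Hecke algebra

`V(z)` has the basis `(u_l)_{l ∈ ℤ}`; it is identified with
`(⨁_{m=1}^n K v_m) ⊗ K[z, z⁻¹]` through `z^r v_m = u_{m - n r}`. -/

/-- The `N`-th tensor power of `V(z)`: the basis vector indexed by `l : Fin N → ℤ` is
`u_{l 0} ⊗ u_{l 1} ⊗ ⋯ ⊗ u_{l (N-1)}`. -/
abbrev Tensor (K : Type*) [Field K] (N : ℕ) : Type _ := (Fin N → ℤ) →₀ K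

/-- The index `m ∈ {1, …, n}` in `u_l = z^r v_m`. -/
def vIndex (n : ℕ) (l : ℤ) : ℤ := (l - 1) % (n : ℤ) + 1

/-- The exponent `r` in `u_l = z^r v_m`. -/
def zExponent (n : ℕ) (l : ℤ) : ℤ := -((l - 1) / (n : ℤ))

theorem vIndex_sub_mul_zExponent (n : ℕ) (l : ℤ) :
    vIndex n l - (n : ℤ) * zExponent n l = l := by
  unfold vIndex zExponent
  have h := Int.emod_add_mul_ediv (l - 1) (n : ℤ)
  linarith

variable {K : Type*} [Field K]

/-- Laurent polynomials in two variables: `Finsupp.single (a, b) 1` is `z₁^a z₂^b`. -/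
abbrev Laurent₂ (K : Type*) [Field K] : Type _ := (ℤ × ℤ) →₀ K

/-- The divided difference `(f - σ f) / (z₁ - z₂)` of the monomial `f = z₁^a z₂^b`. -/
def dividedDifference (a b : ℤ) : Laurent₂ K :=
  ∑ s ∈ Finset.range (a - b).toNat, Finsupp.single (a - 1 - (s : ℤ), b + (s : ℤ)) 1
    - ∑ s ∈ Finset.range (b - a).toNat, Finsupp.single (b - 1 - (s : ℤ), a + (s : ℤ)) 1

/-- Multiplication by `z₁`. -/
def mulZ₁ : Laurent₂ K →ₗ[K] Laurent₂ K :=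
  Finsupp.lmapDomain K K fun r => (r.1 + 1, r.2)

/-- `f ↦ (v_m ⊗ v_{m'}) · f(z_a, z_b)`, placed in the tensor factors `a` and `b`; the other
factors are those of `u_{l 0} ⊗ ⋯ ⊗ u_{l (N-1)}`. -/
def place (n : ℕ) {N : ℕ} (a b : Fin N) (l : Fin N → ℤ) (m m' : ℤ) :
    Laurent₂ K →ₗ[K] Tensor K N :=
  Finsupp.lmapDomain K K fun r =>
    Function.update (Function.update l a (m - (n : ℤ) * r.1)) b (m' - (n : ℤ) * r.2)

/-- The image of `u_{l 0} ⊗ ⋯ ⊗ u_{l (N-1)}` under the Hecke generator that acts on the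
consecutive tensor factors `a` and `b`. -/
def heckeOnBasis (q : K) (n : ℕ) {N : ℕ} (a b : Fin N) (l : Fin N → ℤ) : Tensor K N :=
  let m₁ := vIndex n (l a)
  let m₂ := vIndex n (l b)
  let r₁ := zExponent n (l a)
  let r₂ := zExponent n (l b)
  if m₁ < m₂ then
    (-q⁻¹) • place n a b l m₂ m₁ (Finsupp.single (r₂, r₁) 1)
      + (q⁻¹ ^ 2 - 1) • place n a b l m₁ m₂ (dividedDifference (r₁ + 1) r₂)
  else if m₁ = m₂ then
    -place n a b l m₁ m₂ (Finsupp.single (r₂, r₁) 1)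
      + (q⁻¹ ^ 2 - 1) • place n a b l m₁ m₂ (mulZ₁ (dividedDifference r₁ r₂))
  else
    (-q⁻¹) • place n a b l m₂ m₁ (Finsupp.single (r₂, r₁) 1)
      + (q⁻¹ ^ 2 - 1) • place n a b l m₁ m₂ (mulZ₁ (dividedDifference r₁ r₂))

/-- The generator `T_{i+1}` of the Hecke algebra `H_N(q⁻²)`, acting (from the right) on
`V(z)^{⊗ N}`; meaningful for `i + 1 < N`. -/
def heckeT (q : K) (n N i : ℕ) : Tensor K N →ₗ[K] Tensor K N :=
  if h : i + 1 < N then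
    Finsupp.linearCombination K
      (heckeOnBasis q n (⟨i, Nat.lt_of_succ_lt h⟩ : Fin N) (⟨i + 1, h⟩ : Fin N))
  else 0

/-- The right action of `T_{i₁} T_{i₂} ⋯ T_{iᵣ}`: `T_{i₁}` is applied first. -/
def heckeWord (q : K) (n N : ℕ) (w : List ℕ) : Tensor K N →ₗ[K] Tensor K N :=
  w.foldl (fun f i => heckeT q n N i ∘ₗ f) LinearMap.id

/-- The number of inversions of `σ` whose larger value is `j`. -/
def inversions {N : ℕ} (σ : Equiv.Perm (Fin N)) (j : Fin N) : ℕ :=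
  (Finset.univ.filter fun i : Fin N => i < j ∧ σ.symm j < σ.symm i).card

/-- A reduced decomposition of `σ`, in which the letter `i` stands for the transposition
`(i, i+1)`: the product, for `j = 1, …, N-1`, of the words
`(j-1, j) (j-2, j-1) ⋯ (j-c, j-c+1)`, `c` being the number of inversions of `σ` with larger
value `j`. -/
def reducedWord {N : ℕ} (σ : Equiv.Perm (Fin N)) : List ℕ :=
  (List.finRange N).flatMap fun j =>
    (List.range (inversions σ j)).map fun s => (j : ℕ) - 1 - s

/-- The `q`-antisymmetrizer `A^{(N)} = ∑_{σ ∈ S_N} T_σ`. -/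
def antisymmetrizer (q : K) (n N : ℕ) : Tensor K N →ₗ[K] Tensor K N :=
  ∑ σ : Equiv.Perm (Fin N), heckeWord q n N (reducedWord σ)

/-- The `q`-exterior power `⋀_q^N V(z) = V(z)^{⊗ N} / ker A^{(N)}`. -/
def QWedge (q : K) (n N : ℕ) : Type _ :=
  Tensor K N ⧸ LinearMap.ker (antisymmetrizer q n N)

instance (q : K) (n N : ℕ) : AddCommGroup (QWedge q n N) :=
  inferInstanceAs (AddCommGroup (Tensor K N ⧸ LinearMap.ker (antisymmetrizer q n N)))

instance (q : K) (n N : ℕ) : Module K (QWedge q n N) :=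
  inferInstanceAs (Module K (Tensor K N ⧸ LinearMap.ker (antisymmetrizer q n N)))

/-- The projection of `V(z)^{⊗ N}` onto `⋀_q^N V(z)`; it maps `u_{i₁} ⊗ ⋯ ⊗ u_{i_N}` to
`u_{i₁} ∧_q ⋯ ∧_q u_{i_N}`. -/
def toWedge (q : K) (n N : ℕ) : Tensor K N →ₗ[K] QWedge q n N :=
  (LinearMap.ker (antisymmetrizer q n N)).mkQ

/-! ### The thermodynamic limit -/

/-- `w ↦ w ⊗ u_{-N}`. -/
def extend (K : Type*) [Field K] (N : ℕ) : Tensor K N →ₗ[K] Tensor K (N + 1) :=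
  Finsupp.lmapDomain K K fun l => Fin.snoc (α := fun _ => ℤ) l (-(N : ℤ))

/-- `w ↦ w ⊗ u_{-N} ⊗ u_{-N-1} ⊗ ⋯ ⊗ u_{-N-d+1}`. -/
def extendBy (K : Type*) [Field K] (N : ℕ) :
    (d : ℕ) → Tensor K N →ₗ[K] Tensor K (N + d)
  | 0 => LinearMap.id
  | d + 1 => extend K (N + d) ∘ₗ extendBy K N d

/-- The relations identifying the class of `w` in `⋀_q^N V(z)` with the class of
`w ⊗ u_{-N}` in `⋀_q^{N+1} V(z)`. -/
def limitRelations (q : K) (n : ℕ) : Submodule K (DirectSum ℕ fun N => QWedge q n N) :=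
  Submodule.span K
    {x | ∃ (N : ℕ) (w : Tensor K N),
      x = DirectSum.lof K ℕ (fun N => QWedge q n N) N (toWedge q n N w)
        - DirectSum.lof K ℕ (fun N => QWedge q n N) (N + 1)
            (toWedge q n (N + 1) (extend K N w))}

/-- The `q`-wedge Fock space: the inductive limit of the `⋀_q^N V(z)` along the maps
`w ↦ w ∧_q u_{-N}`. -/
abbrev FockSpace (q : K) (n : ℕ) : Type _ :=
  (DirectSum ℕ fun N => QWedge q n N) ⧸ limitRelations q n

/-- The class of `w` in the Fock space; for `w = u_{i₁} ⊗ ⋯ ⊗ u_{i_N}` it is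
`u_{i₁} ∧_q ⋯ ∧_q u_{i_N} ∧_q u_{-N} ∧_q u_{-N-1} ∧_q ⋯`. -/
def toFock (q : K) (n N : ℕ) : Tensor K N →ₗ[K] FockSpace q n :=
  (limitRelations q n).mkQ ∘ₗ DirectSum.lof K ℕ (fun N => QWedge q n N) N ∘ₗ
    toWedge q n N

/-- `|λ⟩ = u_{λ₁} ∧_q u_{λ₂ - 1} ∧_q u_{λ₃ - 2} ∧_q ⋯`. -/
def ket (q : K) (n : ℕ) (lam : YoungDiagram) : FockSpace q n :=
  toFock q n (lam.colLen 0)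
    (Finsupp.single (fun i : Fin (lam.colLen 0) => (lam.rowLen i : ℤ) - (i : ℤ)) 1)

/-- The action of the monomial `y_1^{a_1} ⋯ y_N^{a_N}`, where `y_i` acts as `z_i⁻¹`, that is,
as `u_l ↦ u_{l+n}` in the `i`-th tensor factor. -/
def yMonomial (K : Type*) [Field K] (n : ℕ) {N : ℕ} (a : Fin N → ℤ) :
    Tensor K N →ₗ[K] Tensor K N :=
  Finsupp.lmapDomain K K fun l i => l i + (n : ℤ) * a i

/-- `e_k(y_1, …, y_N)`. -/
def esymmY (K : Type*) [Field K] (n k N : ℕ) : Tensor K N →ₗ[K] Tensor K N :=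
  ∑ S ∈ (Finset.univ : Finset (Fin N)).powersetCard k,
    yMonomial K n fun i => if i ∈ S then 1 else 0

/-- `e_k(y_1⁻¹, …, y_N⁻¹)`. -/
def esymmYInv (K : Type*) [Field K] (n k N : ℕ) : Tensor K N →ₗ[K] Tensor K N :=
  ∑ S ∈ (Finset.univ : Finset (Fin N)).powersetCard k,
    yMonomial K n fun i => if i ∈ S then -1 else 0

/-- `E` is the thermodynamic limit of the operators `X N` on `V(z)^{⊗ N}`: for every vector
`w` of `V(z)^{⊗ N}`, the image in the Fock space of
`X (N + d) (w ⊗ u_{-N} ⊗ ⋯ ⊗ u_{-N-d+1})` is, for all large `d`, equal to `E` applied to the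
class of `w`. As every vector of the Fock space is such a class, there is at most one
such `E`. -/
def IsThermodynamicLimit (q : K) (n : ℕ) (X : (N : ℕ) → Tensor K N →ₗ[K] Tensor K N)
    (E : FockSpace q n →ₗ[K] FockSpace q n) : Prop :=
  ∀ (N : ℕ) (w : Tensor K N), ∀ᶠ d in Filter.atTop,
    toFock q n (N + d) (X (N + d) (extendBy K N d w)) = E (toFock q n N w)

/-! ### Ribbons

The cell `(i, j)` lies in row `i` and column `j`. The bottom row is row `0` (French
convention), so rows are numbered upwards, and columns from left to right. -/

/-- `R` is an `n`-ribbon: a strip of `n` cells each of which (after the first) is directly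
above, or directly to the left of, the preceding one; equivalently, a connected skew shape
with `n` cells and without a `2 × 2` square. -/
def IsRibbon (n : ℕ) (R : Finset (ℕ × ℕ)) : Prop :=
  ∃ c : ℕ → ℕ × ℕ,
    (∀ i, i + 1 < n →
      ((c (i + 1)).1 = (c i).1 + 1 ∧ (c (i + 1)).2 = (c i).2) ∨
      ((c (i + 1)).1 = (c i).1 ∧ (c (i + 1)).2 + 1 = (c i).2)) ∧
    R = (Finset.range n).image c

/-- `x` is the initial cell of `R`: its rightmost and bottommost cell. -/
def IsInitialCell (R : Finset (ℕ × ℕ)) (x : ℕ × ℕ) : Prop :=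
  x ∈ R ∧ ∀ y ∈ R, x.1 ≤ y.1 ∧ y.2 ≤ x.2

/-- The height of a ribbon: the number of rows that it meets. -/
def height (R : Finset (ℕ × ℕ)) : ℕ := (R.image Prod.fst).card

/-- `T` is a tiling that makes `β / α` a horizontal `n`-ribbon strip of weight `k`: it consists
of `k` pairwise disjoint `n`-ribbons with union `β / α`, the initial cell of each of which is
the bottom cell of `β / α` in its column. -/
structure IsHorizontalStripTiling (n k : ℕ) (β α : YoungDiagram)
    (T : Finset (Finset (ℕ × ℕ))) : Prop where
  le : α ≤ β
  ribbon : ∀ R ∈ T, IsRibbon n R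
  disjoint : (T : Set (Finset (ℕ × ℕ))).PairwiseDisjoint id
  union : T.biUnion id = β.cells \ α.cells
  card : T.card = k
  initial : ∀ R ∈ T, ∃ x, IsInitialCell R x ∧ x.1 = α.colLen x.2

open Classical in
/-- `Tab_n(β/α, (k))`: the `n`-ribbon tableaux of shape `β / α` and weight `(k)`, each given by
its set of ribbons. -/
def ribbonTableaux (n k : ℕ) (β α : YoungDiagram) : Finset (Finset (Finset (ℕ × ℕ))) :=
  (β.cells \ α.cells).powerset.powerset.filter (IsHorizontalStripTiling n k β α)

/-- Twice the spin: the sum over the ribbons `R` of `T` of `height R - 1`. -/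
def twiceSpin (T : Finset (Finset (ℕ × ℕ))) : ℕ := ∑ R ∈ T, (height R - 1)

/-- The conjugate `T'` of a ribbon tableau `T`: rows and columns are exchanged. If `T` tiles
`λ' / ν'`, then `T'` tiles `λ / ν`. -/
def conjugate (T : Finset (Finset (ℕ × ℕ))) : Finset (Finset (ℕ × ℕ)) :=
  T.image fun R => R.image Prod.swap

/-- `∑_{T ∈ Tab_n(λ'/ν', (k))} (-q)^{-2 s(T')}`. -/
def ribbonCoeff (q : K) (n k : ℕ) (lam nu : YoungDiagram) : K :=
  ∑ T ∈ ribbonTableaux n k lam.transpose nu.transpose,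
    (-q) ^ (-(twiceSpin (conjugate T) : ℤ))

end QFock

end

/-!
Evaluating the monomials of a tensor at a point of a field, separately for each sequence of vectors
`v_m`, turns the Hecke generators into Demazure–Lusztig operators. The generic point separates
tensors, so the generators satisfy the braid relations and commute with the symmetric Laurent
polynomials in the `y_i`. The antisymmetrizer is a product of sums over coset representatives, and
by the braid relations it kills every `f` with `T_i f = -f`. Hence two adjacent equal factors make a
wedge vanish, and `u_l ∧ u_m = -q⁻¹ u_m ∧ u_l` if `l < m < l + n`.

On an infinite wedge `u_{J 0} ∧ u_{J 1} ∧ ⋯` the operators `e_k(y^{±1})` move `k` of the beads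
`J i` by `±n`. If one of them lies far out in the vacuum, then a moved bead lands on one at rest
and the term straightens to `0`; so the operators stabilize and have a limit. In `|λ⟩`, the moved
beads trace out the ribbons of a horizontal ribbon strip, a moved bead overtakes one bead for each
row of its ribbon but the first, and straightening produces the power of `-q⁻¹` that records the
spin.
-/

noncomputable section

namespace QFock

variable {K : Type*} [Field K]

/-! ### Evaluation of tensors at points -/

section Evaluation

variable {L : Type*} [Field L] [Algebra K L]

/-- The value of `u_l` at the colour `m` and the point `x`: the function on
`{colours} × {points}` that is `x ^ r` on the colour `m₀` if `u_l = z^r v_{m₀}`, and `0` on the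
other colours. -/
def evFactor (n : ℕ) (l m : ℤ) (x : L) : L :=
  if vIndex n l = m then x ^ zExponent n l else 0

/-- The value of `u_{l 0} ⊗ ⋯ ⊗ u_{l (N-1)}` at the colours `m` and the point `z`. -/
def evBasis (n : ℕ) {N : ℕ} (l m : Fin N → ℤ) (z : Fin N → L) : L :=
  ∏ i, evFactor n (l i) (m i) (z i)

/-- The value of a tensor at the colours `m` and the point `z`: its coefficient of `v_m`, a
Laurent polynomial, evaluated at `z`. The coordinates of `z` may lie in an extension of `K`. -/
def ev (n : ℕ) {N : ℕ} (m : Fin N → ℤ) (z : Fin N → L) : Tensor K N →ₗ[K] L :=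
  Finsupp.linearCombination K fun l => evBasis n l m z

@[simp] theorem ev_single (n : ℕ) {N : ℕ} (l m : Fin N → ℤ) (z : Fin N → L) (c : K) :
    ev n m z (Finsupp.single l c) = c • evBasis n l m z :=
  Finsupp.linearCombination_single ..

/-- Evaluation of a Laurent polynomial in two variables. -/
def laurentEval (x y : L) : Laurent₂ K →ₗ[K] L :=
  Finsupp.linearCombination K fun r => x ^ r.1 * y ^ r.2

@[simp] theorem laurentEval_single (x y : L) (r : ℤ × ℤ) (c : K) :
    laurentEval x y (Finsupp.single r c) = c • (x ^ r.1 * y ^ r.2) :=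
  Finsupp.linearCombination_single ..

theorem laurentEval_mulZ₁ {x : L} (hx : x ≠ 0) (y : L) (f : Laurent₂ K) :
    laurentEval x y (mulZ₁ f) = x * laurentEval x y f := by
  induction f using Finsupp.induction_linear with
  | zero => simp
  | add f g hf hg => simp [hf, hg, mul_add]
  | single r c =>
    simp only [mulZ₁, Finsupp.lmapDomain_apply, Finsupp.mapDomain_single, laurentEval_single,
      zpow_add_one₀ hx, mul_smul_comm]
    ring_nf

theorem sub_mul_laurentEval_geom_sum {x y : L} (hx : x ≠ 0) (hy : y ≠ 0) (b : ℤ) (d : ℕ) :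
    (x - y) * laurentEval x y
        (∑ s ∈ Finset.range d, Finsupp.single (b + d - 1 - (s : ℤ), b + (s : ℤ)) (1 : K)) =
      x ^ (b + d) * y ^ b - x ^ b * y ^ (b + d) := by
  have telescope : ∀ s : ℕ, (x - y) * (x ^ (b + d - 1 - (s : ℤ)) * y ^ (b + (s : ℤ))) =
      x ^ (b + d - (s : ℤ)) * y ^ (b + (s : ℤ)) -
        x ^ (b + d - ((s + 1 : ℕ) : ℤ)) * y ^ (b + ((s + 1 : ℕ) : ℤ)) := fun s => by
    have hx' : x ^ (b + d - (s : ℤ)) = x ^ (b + d - 1 - (s : ℤ)) * x := by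
      rw [← zpow_add_one₀ hx]; ring_nf
    have hy' : y ^ (b + ((s + 1 : ℕ) : ℤ)) = y ^ (b + (s : ℤ)) * y := by
      rw [← zpow_add_one₀ hy]; push_cast; ring_nf
    rw [hx', hy', Nat.cast_succ, show b + d - ((s : ℤ) + 1) = b + d - 1 - s by ring]
    ring
  simp only [map_sum, laurentEval_single, one_smul, Finset.mul_sum, telescope]
  rw [Finset.sum_range_sub' (fun s : ℕ => x ^ (b + d - (s : ℤ)) * y ^ (b + (s : ℤ)))]
  simp

theorem sub_mul_laurentEval_dividedDifference {x y : L} (hx : x ≠ 0) (hy : y ≠ 0) (a b : ℤ) :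
    (x - y) * laurentEval x y (dividedDifference a b : Laurent₂ K) =
      x ^ a * y ^ b - x ^ b * y ^ a := by
  rcases le_total b a with h | h <;> obtain ⟨d, rfl⟩ := Int.le.dest h
  · have := sub_mul_laurentEval_geom_sum (K := K) hx hy b d
    simpa [dividedDifference] using this
  · have := sub_mul_laurentEval_geom_sum (K := K) hx hy a d
    simp only [dividedDifference, add_sub_cancel_left, Int.toNat_natCast, sub_add_cancel_left,
      Int.toNat_neg_natCast, Finset.range_zero, Finset.sum_empty, zero_sub, map_neg, mul_neg,
      this, neg_sub]

theorem vIndex_sub_mul {n : ℕ} {m : ℤ} (hm : m ∈ Set.Icc 1 (n : ℤ)) (r : ℤ) :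
    vIndex n (m - n * r) = m := by
  obtain ⟨hm₁, hmn⟩ := hm
  rw [vIndex, show m - n * r - 1 = (m - 1) + n * (-r) by ring, Int.add_mul_emod_self_left,
    Int.emod_eq_of_lt (by lia) (by lia), sub_add_cancel]

theorem zExponent_sub_mul {n : ℕ} {m : ℤ} (hm : m ∈ Set.Icc 1 (n : ℤ)) (r : ℤ) :
    zExponent n (m - n * r) = r := by
  have hn : (n : ℤ) ≠ 0 := by have := hm.1.trans hm.2; lia
  have h := vIndex_sub_mul_zExponent n (m - n * r)
  rw [vIndex_sub_mul hm] at h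
  exact mul_left_cancel₀ hn (by linarith)

theorem vIndex_mem_Icc {n : ℕ} (hn : 1 ≤ n) (l : ℤ) : vIndex n l ∈ Set.Icc 1 (n : ℤ) := by
  have h₀ := Int.emod_nonneg (l - 1) (b := (n : ℤ)) (by lia)
  have h₁ := Int.emod_lt_of_pos (l - 1) (b := (n : ℤ)) (by lia)
  unfold vIndex
  constructor <;> lia

theorem eq_of_vIndex_eq_of_zExponent_eq {n : ℕ} {l l' : ℤ} (hv : vIndex n l = vIndex n l')
    (hz : zExponent n l = zExponent n l') : l = l' := by
  rw [← vIndex_sub_mul_zExponent n l, ← vIndex_sub_mul_zExponent n l', hv, hz]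

/-- The product of the factors of `evBasis` away from the positions `a` and `b`. -/
def evRest (n : ℕ) {N : ℕ} (a b : Fin N) (l m : Fin N → ℤ) (z : Fin N → L) : L :=
  ∏ i ∈ {a, b}ᶜ, evFactor n (l i) (m i) (z i)

theorem evBasis_eq_evRest_mul {n N : ℕ} {a b : Fin N} (hab : a ≠ b) {l l' m m' : Fin N → ℤ}
    {z z' : Fin N → L} (hl : Set.EqOn l' l {a, b}ᶜ) (hm : Set.EqOn m' m {a, b}ᶜ)
    (hz : Set.EqOn z' z {a, b}ᶜ) :
    evBasis n l' m' z' = evRest n a b l m z *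
      if vIndex n (l' a) = m' a ∧ vIndex n (l' b) = m' b then
        z' a ^ zExponent n (l' a) * z' b ^ zExponent n (l' b) else 0 := by
  rw [evBasis, evRest, ← Finset.prod_compl_mul_prod {a, b}, Finset.prod_pair hab]
  congr 1
  · refine Finset.prod_congr rfl fun i hi => ?_
    have hi' : i ∈ ({a, b}ᶜ : Set (Fin N)) := by simpa using hi
    rw [hl hi', hm hi', hz hi']
  · simp only [evFactor, ite_zero_mul_ite_zero]

theorem eqOn_comp_swap {ι X : Type*} [DecidableEq ι] (f : ι → X) (a b : ι) :
    Set.EqOn (f ∘ Equiv.swap a b) f {a, b}ᶜ := fun i hi => by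
  simp only [Set.mem_compl_iff, Set.mem_insert_iff, Set.mem_singleton_iff, not_or] at hi
  simp [Equiv.swap_apply_of_ne_of_ne hi.1 hi.2]

theorem ev_place {n N : ℕ} {a b : Fin N} (hab : a ≠ b) (l m : Fin N → ℤ) (z : Fin N → L)
    {p p' : ℤ} (hp : p ∈ Set.Icc 1 (n : ℤ)) (hp' : p' ∈ Set.Icc 1 (n : ℤ)) (f : Laurent₂ K) :
    ev n m z (place n a b l p p' f) =
      evRest n a b l m z * if p = m a ∧ p' = m b then laurentEval (z a) (z b) f else 0 := by
  induction f using Finsupp.induction_linear with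
  | zero => simp
  | add f g hf hg => rw [map_add, map_add, hf, hg, map_add, ← mul_add]; split_ifs <;> simp
  | single r c =>
    have hl : Set.EqOn (Function.update (Function.update l a (p - n * r.1)) b (p' - n * r.2)) l
        {a, b}ᶜ := fun i hi => by
      simp only [Set.mem_compl_iff, Set.mem_insert_iff, Set.mem_singleton_iff, not_or] at hi
      rw [Function.update_of_ne hi.2, Function.update_of_ne hi.1]
    simp only [place, Finsupp.lmapDomain_apply, Finsupp.mapDomain_single, ev_single,
      evBasis_eq_evRest_mul hab hl (Set.eqOn_refl m _) (Set.eqOn_refl z _), laurentEval_single,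
      Function.update_self, Function.update_of_ne hab, vIndex_sub_mul hp, vIndex_sub_mul hp',
      zExponent_sub_mul hp, zExponent_sub_mul hp']
    split_ifs <;> simp

end Evaluation

/-! ### Demazure–Lusztig operators -/

section Demazure

variable {L ι C : Type*} [Field L] [DecidableEq ι] [LinearOrder C]

/-- The Demazure–Lusztig operator in the positions `a` and `b`, on functions of colours `m` and
points `z`. It is the action of a Hecke generator on the values of a tensor; the three cases of
that action differ only in the first summand and in the coefficient of `F m (z ∘ swap a b)`. -/
def demazure (q : L) (a b : ι) (F : (ι → C) → (ι → L) → L) (m : ι → C) (z : ι → L) : L :=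
  (if m a = m b then -F m (z ∘ Equiv.swap a b)
    else -q⁻¹ * F (m ∘ Equiv.swap a b) (z ∘ Equiv.swap a b)) +
  (q⁻¹ ^ 2 - 1) * ((z a * F m z -
    (if m a < m b then z b else z a) * F m (z ∘ Equiv.swap a b)) / (z a - z b))

theorem demazure_add (q : L) (a b : ι) (F G : (ι → C) → (ι → L) → L) :
    demazure q a b (F + G) = demazure q a b F + demazure q a b G := by
  funext m z
  simp only [demazure, Pi.add_apply]
  split_ifs <;> ring

theorem demazure_symm_mul (q : L) (a b : ι) (c : (ι → L) → L) (F : (ι → C) → (ι → L) → L)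
    (m : ι → C) (z : ι → L) (hc : c (z ∘ Equiv.swap a b) = c z) :
    demazure q a b (fun m z => c z * F m z) m z = c z * demazure q a b F m z := by
  simp only [demazure, hc]
  split_ifs <;> ring

theorem demazure_congr (q : L) (a b : ι) {F G : (ι → C) → (ι → L) → L}
    (h : ∀ m (z : ι → L), Function.Injective z → (∀ i, z i ≠ 0) → F m z = G m z)
    (m : ι → C) {z : ι → L} (hz : Function.Injective z) (h₀ : ∀ i, z i ≠ 0) :
    demazure q a b F m z = demazure q a b G m z := by
  have hz' : Function.Injective (z ∘ Equiv.swap a b) := hz.comp (Equiv.injective _)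
  simp only [demazure, h _ z hz h₀, h _ _ hz' fun _ => h₀ _]

theorem comp_swap_comp_swap {X : Type*} (i j : ι) (f : ι → X) :
    (f ∘ Equiv.swap i j) ∘ Equiv.swap i j = f := by
  funext t
  simp

theorem comp_swap_braid {X : Type*} {i j k : ι} (hij : i ≠ j) (hik : i ≠ k) (hjk : j ≠ k)
    (f : ι → X) :
    ((f ∘ Equiv.swap i j) ∘ Equiv.swap j k) ∘ Equiv.swap i j =
      ((f ∘ Equiv.swap j k) ∘ Equiv.swap i j) ∘ Equiv.swap j k := by
  have h : Equiv.swap i j * Equiv.swap j k * Equiv.swap i j =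
      Equiv.swap j k * Equiv.swap i j * Equiv.swap j k := by
    rw [Equiv.swap_mul_swap_mul_swap hij hik, Equiv.swap_comm i j, Equiv.swap_comm j k,
      Equiv.swap_mul_swap_mul_swap hjk.symm hik.symm, Equiv.swap_comm k i]
  exact congrArg (fun σ : Equiv.Perm ι => f ∘ σ) h

set_option maxHeartbeats 4000000 in
-- The colours of the three positions have 13 relative orders, and for each of them the two sides
-- are rational functions with up to six values of `F`.
theorem demazure_braid (q : L) {i j k : ι} (hij : i ≠ j) (hik : i ≠ k) (hjk : j ≠ k)
    (F : (ι → C) → (ι → L) → L) (m : ι → C) {z : ι → L} (hz : Function.Injective z) :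
    demazure q i j (demazure q j k (demazure q i j F)) m z =
      demazure q j k (demazure q i j (demazure q j k F)) m z := by
  have hzij : z i - z j ≠ 0 := sub_ne_zero.2 (hz.ne hij)
  have hzik : z i - z k ≠ 0 := sub_ne_zero.2 (hz.ne hik)
  have hzjk : z j - z k ≠ 0 := sub_ne_zero.2 (hz.ne hjk)
  have hzji : z j - z i = -(z i - z j) := by ring
  have hzkj : z k - z j = -(z j - z k) := by ring
  have hji := Equiv.swap_apply_of_ne_of_ne hik.symm hjk.symm
  have hkj := Equiv.swap_apply_of_ne_of_ne hij hik
  have compare : ∀ c d : C, (c < d ∧ ¬d < c ∧ c ≠ d ∧ d ≠ c) ∨ c = d ∨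
      (d < c ∧ ¬c < d ∧ c ≠ d ∧ d ≠ c) := fun c d => by grind
  rcases compare (m i) (m j) with hmij | hmij | hmij <;>
  rcases compare (m j) (m k) with hmjk | hmjk | hmjk <;>
  rcases compare (m i) (m k) with hmik | hmik | hmik <;>
  try grind only
  all_goals
    simp only [demazure, Function.comp_apply, Equiv.swap_apply_left, Equiv.swap_apply_right, hji,
      hkj, comp_swap_comp_swap, comp_swap_braid hij hik hjk, hzji, hzkj, hmij, hmjk, hmik,
      lt_self_iff_false, if_true, if_false]
    generalize hβ : q⁻¹ ^ 2 - 1 = β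
    generalize q⁻¹ = α at *
    field_simp
    first
    | ring1
    | (rw [← hβ]; ring1)

theorem comp_swap_comp_swap_comm {X : Type*} {a b c d : ι} (hac : a ≠ c) (had : a ≠ d)
    (hbc : b ≠ c) (hbd : b ≠ d) (f : ι → X) :
    (f ∘ Equiv.swap c d) ∘ Equiv.swap a b = (f ∘ Equiv.swap a b) ∘ Equiv.swap c d := by
  have disjoint : Equiv.Perm.Disjoint (Equiv.swap a b) (Equiv.swap c d) := fun t => by grind
  exact congrArg (fun σ : Equiv.Perm ι => f ∘ σ) disjoint.commute.eq.symm

theorem demazure_comm (q : L) {a b c d : ι} (hac : a ≠ c) (had : a ≠ d) (hbc : b ≠ c)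
    (hbd : b ≠ d) (F : (ι → C) → (ι → L) → L) :
    demazure q a b (demazure q c d F) = demazure q c d (demazure q a b F) := by
  funext m z
  simp only [demazure, Function.comp_apply, Equiv.swap_apply_of_ne_of_ne hac had,
    Equiv.swap_apply_of_ne_of_ne hbc hbd, Equiv.swap_apply_of_ne_of_ne hac.symm hbc.symm,
    Equiv.swap_apply_of_ne_of_ne had.symm hbd.symm, comp_swap_comp_swap_comm hac had hbc hbd]
  split_ifs <;> ring

end Demazure

section HeckeDemazure

variable {L : Type*} [Field L] [Algebra K L]

theorem ev_heckeOnBasis (q : K) {n : ℕ} (hn : 1 ≤ n) {N : ℕ} {a b : Fin N} (hab : a ≠ b)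
    (l m : Fin N → ℤ) {z : Fin N → L} (hz : z a ≠ z b) (ha : z a ≠ 0) (hb : z b ≠ 0) :
    ev n m z (heckeOnBasis q n a b l) =
      demazure (algebraMap K L q) a b (fun m z => evBasis n l m z) m z := by
  have hsub : z a - z b ≠ 0 := sub_ne_zero.2 hz
  have hdiv : ∀ r s : ℤ, laurentEval (z a) (z b) (dividedDifference r s : Laurent₂ K) =
      (z a ^ r * z b ^ s - z a ^ s * z b ^ r) / (z a - z b) := fun r s => by
    rw [eq_div_iff hsub, mul_comm, sub_mul_laurentEval_dividedDifference ha hb]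
  have hm := eqOn_comp_swap m a b
  have hz' := eqOn_comp_swap z a b
  have hl := Set.eqOn_refl l {a, b}ᶜ
  have va := vIndex_mem_Icc hn (l a)
  have vb := vIndex_mem_Icc hn (l b)
  simp only [demazure, evBasis_eq_evRest_mul hab hl (Set.eqOn_refl m _) hz',
    evBasis_eq_evRest_mul hab hl (Set.eqOn_refl m _) (Set.eqOn_refl z _),
    evBasis_eq_evRest_mul hab hl hm hz', Function.comp_apply, Equiv.swap_apply_left,
    Equiv.swap_apply_right]
  rcases lt_trichotomy (vIndex n (l a)) (vIndex n (l b)) with h | h | h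
  case' inl => simp only [heckeOnBasis, h, if_true]
  case' inr.inl => simp only [heckeOnBasis, h, lt_self_iff_false, if_true, if_false]; rw [h] at va
  case' inr.inr => simp only [heckeOnBasis, h.not_gt, h.ne', if_false]
  all_goals
    simp only [map_add, map_smul, map_neg, ev_place hab l m z va vb, ev_place hab l m z vb va,
      laurentEval_single, hdiv, laurentEval_mulZ₁ ha, zpow_add_one₀ ha, zpow_add_one₀ hb,
      Algebra.smul_def, map_sub, map_inv₀, map_pow, map_one]
    split_ifs <;> first | (exfalso; lia) | ring1

theorem ev_linearCombination_heckeOnBasis (q : K) {n : ℕ} (hn : 1 ≤ n) {N : ℕ} {a b : Fin N}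
    (hab : a ≠ b) (f : Tensor K N) (m : Fin N → ℤ) {z : Fin N → L} (hz : z a ≠ z b)
    (ha : z a ≠ 0) (hb : z b ≠ 0) :
    ev n m z (Finsupp.linearCombination K (heckeOnBasis q n a b) f) =
      demazure (algebraMap K L q) a b (fun m z => ev n m z f) m z := by
  induction f using Finsupp.induction_linear with
  | zero => simp [demazure]
  | add f g hf hg =>
    simp only [map_add, hf, hg]
    exact (congrFun₂ (demazure_add _ a b _ _) m z).symm
  | single l c =>
    simp only [Finsupp.linearCombination_single, map_smul, ev_single, Algebra.smul_def,
      ev_heckeOnBasis q hn hab l m hz ha hb]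
    exact (demazure_symm_mul _ a b (fun _ => algebraMap K L c) (evBasis n l) m z rfl).symm

end HeckeDemazure

/-! ### The relations of the Hecke algebra -/

/-- The field of fractions of the Laurent polynomials over `K` in `N` variables; an element of
the tensor power is determined by its values at a generic point over this field. -/
abbrev LaurentField (K : Type*) [Field K] (N : ℕ) : Type _ :=
  FractionRing (AddMonoidAlgebra K (Fin N → ℤ))

/-- The monomial with exponents `r`, as an element of `LaurentField K N`. -/
def laurentMonomial (K : Type*) [Field K] (N : ℕ) :
    Multiplicative (Fin N → ℤ) →* LaurentField K N :=
  (algebraMap (AddMonoidAlgebra K (Fin N → ℤ)) (LaurentField K N)).toMonoidHom.comp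
    (AddMonoidAlgebra.of K (Fin N → ℤ))

/-- The generic point, whose coordinates are the variables. -/
def genericPoint (K : Type*) [Field K] (N : ℕ) (i : Fin N) : LaurentField K N :=
  laurentMonomial K N (.ofAdd (Pi.single i 1))

theorem laurentMonomial_injective (K : Type*) [Field K] (N : ℕ) :
    Function.Injective (laurentMonomial K N) :=
  (IsFractionRing.injective (AddMonoidAlgebra K (Fin N → ℤ)) (LaurentField K N)).comp
    AddMonoidAlgebra.of_injective

theorem genericPoint_injective (K : Type*) [Field K] (N : ℕ) :
    Function.Injective (genericPoint K N) := fun i j h => by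
  have h' := congrFun (Multiplicative.ofAdd.injective (laurentMonomial_injective K N h)) i
  by_contra hij
  simp [Pi.single_eq_of_ne hij] at h'

theorem genericPoint_ne_zero {N : ℕ} (i : Fin N) : genericPoint K N i ≠ 0 :=
  ((Group.isUnit _).map (laurentMonomial K N)).ne_zero

theorem prod_genericPoint_zpow {N : ℕ} (r : Fin N → ℤ) :
    ∏ i, genericPoint K N i ^ r i = laurentMonomial K N (.ofAdd r) := by
  simp only [genericPoint, ← map_zpow, ← map_prod, ← ofAdd_zsmul, ← ofAdd_sum, ← Pi.single_smul,
    smul_eq_mul, mul_one, Finset.univ_sum_single]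

/-- The coefficient of `v_m` in a tensor, as a Laurent polynomial in the variables `z`. -/
def laurentCoeff (n : ℕ) {N : ℕ} (m : Fin N → ℤ) :
    Tensor K N →ₗ[K] AddMonoidAlgebra K (Fin N → ℤ) :=
  Finsupp.linearCombination K fun l =>
    if ∀ i, vIndex n (l i) = m i then AddMonoidAlgebra.single (fun i => zExponent n (l i)) 1 else 0

theorem ev_genericPoint (n : ℕ) {N : ℕ} (m : Fin N → ℤ) (f : Tensor K N) :
    ev n m (genericPoint K N) f =
      algebraMap (AddMonoidAlgebra K (Fin N → ℤ)) (LaurentField K N) (laurentCoeff n m f) := by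
  induction f using Finsupp.induction_linear with
  | zero => simp
  | add f g hf hg => simp only [map_add, hf, hg]
  | single l c =>
    simp only [ev_single, laurentCoeff, Finsupp.linearCombination_single, evBasis, evFactor,
      Finset.prod_ite_zero, prod_genericPoint_zpow, Finset.mem_univ, forall_const,
      algebraMap.coe_smul]
    split_ifs
    · rfl
    · simp

theorem coeff_laurentCoeff (n : ℕ) {N : ℕ} (l₀ : Fin N → ℤ) (f : Tensor K N) :
    (laurentCoeff n (fun i => vIndex n (l₀ i)) f).coeff (fun i => zExponent n (l₀ i)) = f l₀ := by
  induction f using Finsupp.induction_linear with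
  | zero => simp
  | add f g hf hg => simp only [map_add, AddMonoidAlgebra.coeff_add, Finsupp.add_apply, hf, hg]
  | single l c =>
    rw [laurentCoeff, Finsupp.linearCombination_single]
    by_cases hl : l = l₀
    · subst hl
      simp
    · split_ifs with hv
      · have hz : (fun i => zExponent n (l i)) ≠ fun i => zExponent n (l₀ i) := fun hz =>
          hl (funext fun i => eq_of_vIndex_eq_of_zExponent_eq (hv i) (congrFun hz i))
        simp [hl, hz]
      · simp [hl]

theorem eq_of_ev_eq (n : ℕ) {N : ℕ} {f g : Tensor K N}
    (h : ∀ m (z : Fin N → LaurentField K N), Function.Injective z → (∀ i, z i ≠ 0) →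
      ev n m z f = ev n m z g) : f = g := by
  ext l
  have h_ev := h (fun i => vIndex n (l i)) _ (genericPoint_injective K N) genericPoint_ne_zero
  simp only [ev_genericPoint] at h_ev
  rw [← coeff_laurentCoeff n l f, IsFractionRing.injective _ _ h_ev, coeff_laurentCoeff]

theorem ev_heckeT {L : Type*} [Field L] [Algebra K L] (q : K) {n : ℕ} (hn : 1 ≤ n) {N i : ℕ}
    (hi : i + 1 < N) (f : Tensor K N) (m : Fin N → ℤ) {z : Fin N → L}
    (hz : Function.Injective z) (h₀ : ∀ i, z i ≠ 0) :
    ev n m z (heckeT q n N i f) = demazure (algebraMap K L q) ⟨i, Nat.lt_of_succ_lt hi⟩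
      ⟨i + 1, hi⟩ (fun m z => ev n m z f) m z := by
  have hne : (⟨i, Nat.lt_of_succ_lt hi⟩ : Fin N) ≠ ⟨i + 1, hi⟩ := by simp
  rw [heckeT, dif_pos hi]
  exact ev_linearCombination_heckeOnBasis q hn hne f m (hz.ne hne) (h₀ _) (h₀ _)

theorem heckeT_eq_zero (q : K) (n : ℕ) {N i : ℕ} (hi : ¬i + 1 < N) : heckeT q n N i = 0 :=
  dif_neg hi

theorem ev_heckeT_heckeT {L : Type*} [Field L] [Algebra K L] (q : K) {n : ℕ} (hn : 1 ≤ n)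
    {N i j : ℕ} (hi : i + 1 < N) (hj : j + 1 < N) (f : Tensor K N) (m : Fin N → ℤ)
    {z : Fin N → L} (hz : Function.Injective z) (h₀ : ∀ i, z i ≠ 0) :
    ev n m z (heckeT q n N i (heckeT q n N j f)) =
      demazure (algebraMap K L q) ⟨i, Nat.lt_of_succ_lt hi⟩ ⟨i + 1, hi⟩
        (demazure (algebraMap K L q) ⟨j, Nat.lt_of_succ_lt hj⟩ ⟨j + 1, hj⟩
          fun m z => ev n m z f) m z :=
  (ev_heckeT q hn hi _ m hz h₀).trans
    (demazure_congr _ _ _ (fun m _ hz h₀ => ev_heckeT q hn hj f m hz h₀) m hz h₀)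

theorem heckeT_braid (q : K) {n : ℕ} (hn : 1 ≤ n) {N i : ℕ} (hi : i + 2 < N) (f : Tensor K N) :
    heckeT q n N i (heckeT q n N (i + 1) (heckeT q n N i f)) =
      heckeT q n N (i + 1) (heckeT q n N i (heckeT q n N (i + 1) f)) := by
  have hi' : i + 1 < N := Nat.lt_of_succ_lt hi
  refine eq_of_ev_eq n fun m z hz h₀ => ?_
  rw [ev_heckeT q hn hi' _ m hz h₀, ev_heckeT q hn hi _ m hz h₀,
    demazure_congr _ _ _ (fun m z hz h₀ => ev_heckeT_heckeT q hn hi hi' f m hz h₀) m hz h₀,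
    demazure_congr _ _ _ (fun m z hz h₀ => ev_heckeT_heckeT q hn hi' hi f m hz h₀) m hz h₀]
  apply demazure_braid _ _ _ _ _ m hz <;> rw [Ne, Fin.mk.injEq] <;> lia

theorem heckeT_comm (q : K) {n : ℕ} (hn : 1 ≤ n) {N i j : ℕ} (hij : i + 1 < j) (f : Tensor K N) :
    heckeT q n N i (heckeT q n N j f) = heckeT q n N j (heckeT q n N i f) := by
  by_cases hj : j + 1 < N
  · have hi : i + 1 < N := hij.trans (Nat.lt_of_succ_lt hj)
    refine eq_of_ev_eq n fun m z hz h₀ => ?_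
    rw [ev_heckeT_heckeT q hn hi hj f m hz h₀, ev_heckeT_heckeT q hn hj hi f m hz h₀]
    refine congrFun₂ (demazure_comm _ ?_ ?_ ?_ ?_ _) m z <;> rw [Ne, Fin.mk.injEq] <;> lia
  · simp [heckeT_eq_zero q n hj]

/-! ### The antisymmetrizer as a product -/

theorem heckeWord_foldl (q : K) (n N : ℕ) (w : List ℕ) (g : Tensor K N →ₗ[K] Tensor K N) :
    w.foldl (fun f i => heckeT q n N i ∘ₗ f) g = heckeWord q n N w ∘ₗ g := by
  induction w generalizing g with
  | nil => rfl
  | cons i w ih =>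
    rw [heckeWord, List.foldl_cons, List.foldl_cons, ih, ih]
    rfl

theorem heckeWord_append (q : K) (n N : ℕ) (w w' : List ℕ) :
    heckeWord q n N (w ++ w') = heckeWord q n N w' ∘ₗ heckeWord q n N w := by
  rw [heckeWord, List.foldl_append, heckeWord_foldl]
  rfl

theorem heckeWord_cons (q : K) (n N i : ℕ) (w : List ℕ) :
    heckeWord q n N (i :: w) = heckeWord q n N w ∘ₗ heckeT q n N i :=
  heckeWord_append q n N [i] w

/-- The sum `1 + T_{j-1} + T_{j-1} T_{j-2} + ⋯ + T_{j-1} ⋯ T_0` over the minimal right coset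
representatives of `S_j` in `S_{j+1}`, for the right action. -/
def cosetSum (q : K) (n N : ℕ) : ℕ → Tensor K N →ₗ[K] Tensor K N
  | 0 => LinearMap.id
  | j + 1 => LinearMap.id + cosetSum q n N j ∘ₗ heckeT q n N j

/-- The product of the first `j` of the sums `cosetSum`: the antisymmetrizer of `S_j`. -/
def cosetProd (q : K) (n N : ℕ) : ℕ → Tensor K N →ₗ[K] Tensor K N
  | 0 => LinearMap.id
  | j + 1 => cosetSum q n N j ∘ₗ cosetProd q n N j

theorem cosetSum_succ_apply (q : K) (n N j : ℕ) (f : Tensor K N) :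
    cosetSum q n N (j + 1) f = f + cosetSum q n N j (heckeT q n N j f) :=
  rfl

theorem cosetProd_succ_apply (q : K) (n N j : ℕ) (f : Tensor K N) :
    cosetProd q n N (j + 1) f = cosetSum q n N j (cosetProd q n N j f) :=
  rfl

theorem cosetSum_apply (q : K) (n N j : ℕ) (f : Tensor K N) :
    cosetSum q n N j f =
      ∑ c : Fin (j + 1), heckeWord q n N ((List.range c).map fun s => j - 1 - s) f := by
  induction j generalizing f with
  | zero => simp [cosetSum, heckeWord]
  | succ j ih =>
    rw [Fin.sum_univ_succ, cosetSum_succ_apply, ih]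
    refine congrArg₂ _ rfl (Finset.sum_congr rfl fun c _ => ?_)
    have shift : (fun s => j + 1 - 1 - s) ∘ Nat.succ = fun s => j - 1 - s :=
      funext fun s => by simp only [Function.comp_apply]; lia
    rw [Fin.val_succ, List.range_succ_eq_map, List.map_cons, heckeWord_cons, List.map_map, shift]
    rfl

theorem cosetProd_apply (q : K) (n N j : ℕ) (f : Tensor K N) :
    cosetProd q n N j f =
      ∑ c : ∀ i : Fin j, Fin (i + 1), heckeWord q n N ((List.finRange j).flatMap fun i =>
        (List.range (c i)).map fun s => (i : ℕ) - 1 - s) f := by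
  induction j with
  | zero => simp [cosetProd, heckeWord]
  | succ j ih =>
    rw [cosetProd_succ_apply, ih, cosetSum_apply,
      ← (Fin.snocEquiv fun i : Fin (j + 1) => Fin (i + 1)).sum_comp, Fintype.sum_prod_type]
    refine Finset.sum_congr rfl fun a _ => ?_
    rw [map_sum]
    refine Finset.sum_congr rfl fun c _ => ?_
    rw [List.finRange_succ_last, List.flatMap_append, heckeWord_append, LinearMap.comp_apply,
      List.flatMap_map]
    simp [Fin.snocEquiv]

theorem inversions_lt {N : ℕ} (σ : Equiv.Perm (Fin N)) (j : Fin N) : inversions σ j < j + 1 := by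
  rw [Nat.lt_succ_iff]
  calc inversions σ j ≤ (Finset.Iio j).card :=
        Finset.card_le_card fun i hi => by simpa using (Finset.mem_filter.1 hi).2.1
    _ = j := by simp

theorem inversions_eq_card_filter_lt {N : ℕ} (σ : Equiv.Perm (Fin N)) (j : Fin N) :
    inversions σ j =
      (Finset.univ.filter fun v => σ.symm j < v ∧ ∀ i, j < i → v ≠ σ.symm i).card := by
  refine Finset.card_equiv σ.symm fun i => ?_
  simp only [Finset.mem_filter_univ, ne_eq, EmbeddingLike.apply_eq_iff_eq]
  constructor
  · exact fun ⟨hij, hσ⟩ => ⟨hσ, fun k hk => (hij.trans hk).ne⟩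
  · refine fun ⟨hσ, hi⟩ => ⟨lt_of_not_ge fun hji => ?_, hσ⟩
    rcases hji.eq_or_lt with rfl | hji
    · exact lt_irrefl _ hσ
    · exact hi i hji rfl

theorem inversions_lt_inversions {N : ℕ} {σ τ : Equiv.Perm (Fin N)} {j : Fin N}
    (h : ∀ i, j < i → σ.symm i = τ.symm i) (hj : σ.symm j < τ.symm j) :
    inversions τ j < inversions σ j := by
  rw [inversions_eq_card_filter_lt, inversions_eq_card_filter_lt]
  refine Finset.card_lt_card (Finset.ssubset_iff_of_subset ?_ |>.2 ⟨τ.symm j, ?_, ?_⟩)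
  · intro v hv
    simp only [Finset.mem_filter_univ] at hv ⊢
    exact ⟨hj.trans hv.1, fun i hi => h i hi ▸ hv.2 i hi⟩
  · rw [Finset.mem_filter_univ]
    exact ⟨hj, fun i hi => h i hi ▸ τ.symm.injective.ne hi.ne⟩
  · simp

theorem inversions_injective {N : ℕ} : Function.Injective (inversions (N := N)) := fun σ τ h => by
  suffices agree : ∀ j, σ.symm j = τ.symm j from
    Equiv.symm_bijective.injective (Equiv.ext agree)
  intro j
  induction j using WellFoundedGT.induction with
  | ind j ih =>
    rcases lt_trichotomy (σ.symm j) (τ.symm j) with hlt | heq | hlt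
    · exact absurd (congrFun h j) (inversions_lt_inversions ih hlt).ne'
    · exact heq
    · exact absurd (congrFun h j) (inversions_lt_inversions (fun i hi => (ih i hi).symm) hlt).ne

/-- The Lehmer code: a permutation is encoded by its inversion numbers, which are arbitrary. -/
def inversionsEquiv (N : ℕ) : Equiv.Perm (Fin N) ≃ ∀ j : Fin N, Fin (j + 1) :=
  Equiv.ofBijective (fun σ j => ⟨inversions σ j, inversions_lt σ j⟩) <| by
    rw [Fintype.bijective_iff_injective_and_card]
    refine ⟨fun σ τ h => inversions_injective (funext fun j => ?_), ?_⟩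
    · exact congrArg Fin.val (congrFun h j)
    · simp only [Fintype.card_perm, Fintype.card_pi, Fintype.card_fin]
      rw [Fin.prod_univ_eq_prod_range (fun j => j + 1), Finset.prod_range_add_one_eq_factorial]

theorem antisymmetrizer_eq_cosetProd (q : K) (n N : ℕ) :
    antisymmetrizer q n N = cosetProd q n N N := by
  refine LinearMap.ext fun f => ?_
  rw [cosetProd_apply, ← (inversionsEquiv N).sum_comp, antisymmetrizer, LinearMap.sum_apply]
  rfl

/-! ### The kernel of the antisymmetrizer -/

theorem cosetSum_comm (q : K) {n : ℕ} (hn : 1 ≤ n) {N i j : ℕ} (hij : i < j) (f : Tensor K N) :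
    cosetSum q n N i (heckeT q n N j f) = heckeT q n N j (cosetSum q n N i f) := by
  induction i generalizing f with
  | zero => rfl
  | succ i ih =>
    simp only [cosetSum_succ_apply, map_add, heckeT_comm q hn hij, ih (Nat.lt_of_succ_lt hij)]

theorem cosetProd_comm (q : K) {n : ℕ} (hn : 1 ≤ n) {N i j : ℕ} (hij : i ≤ j) (f : Tensor K N) :
    cosetProd q n N i (heckeT q n N j f) = heckeT q n N j (cosetProd q n N i f) := by
  induction i with
  | zero => rfl
  | succ i ih =>
    simp only [cosetProd_succ_apply, ih (Nat.le_of_succ_le hij),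
      cosetSum_comm q hn (Nat.lt_of_succ_le hij)]

-- By the braid relation, `f T_s T_{s+1}` is an eigenvector of `T_s` if `f` is one of `T_{s+1}`.
theorem cosetSum_cosetSum_eq_zero (q : K) {n : ℕ} (hn : 1 ≤ n) {N t : ℕ} (ht : t + 1 < N)
    {f : Tensor K N} (hf : heckeT q n N t f = -f) :
    cosetSum q n N (t + 1) (cosetSum q n N t f) = 0 := by
  induction t generalizing f with
  | zero => simp [cosetSum, hf]
  | succ s ih =>
    have cancel : cosetSum q n N (s + 1) (heckeT q n N (s + 1)
        (cosetSum q n N s (heckeT q n N s f))) = 0 := by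
      rw [← cosetSum_comm q hn (Nat.lt_succ_self s)]
      refine ih (Nat.lt_of_succ_lt ht) ?_
      rw [heckeT_braid q hn ht, hf, map_neg, map_neg]
    rw [cosetSum_succ_apply, cosetSum_succ_apply (f := f), map_add, map_add, hf, cancel, map_neg,
      cosetSum_succ_apply]
    abel

theorem antisymmetrizer_eq_zero (q : K) {n : ℕ} (hn : 1 ≤ n) {N t : ℕ} (ht : t + 1 < N)
    {f : Tensor K N} (hf : heckeT q n N t f = -f) : antisymmetrizer q n N f = 0 := by
  rw [antisymmetrizer_eq_cosetProd]
  suffices ∀ j, t + 2 ≤ j → cosetProd q n N j f = 0 from this N ht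
  intro j hj
  induction j, hj using Nat.le_induction with
  | base =>
    refine cosetSum_cosetSum_eq_zero q hn ht ?_
    rw [← cosetProd_comm q hn le_rfl, hf, map_neg]
  | succ j _ ih => rw [cosetProd_succ_apply, ih, map_zero]

theorem toWedge_eq_zero_iff (q : K) (n : ℕ) {N : ℕ} (f : Tensor K N) :
    toWedge q n N f = 0 ↔ antisymmetrizer q n N f = 0 :=
  (Submodule.Quotient.mk_eq_zero (LinearMap.ker (antisymmetrizer q n N))).trans LinearMap.mem_ker

/-! ### Symmetric Laurent polynomials in the `y_i` -/

theorem vIndex_add_mul (n : ℕ) (l a : ℤ) : vIndex n (l + n * a) = vIndex n l := by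
  rw [vIndex, show l + n * a - 1 = l - 1 + n * a by ring, Int.add_mul_emod_self_left, vIndex]

theorem zExponent_add_mul {n : ℕ} (hn : 1 ≤ n) (l a : ℤ) :
    zExponent n (l + n * a) = zExponent n l - a := by
  rw [zExponent, show l + n * a - 1 = l - 1 + n * a by ring,
    Int.add_mul_ediv_left _ _ (by lia), zExponent]
  ring

theorem ev_yMonomial {L : Type*} [Field L] [Algebra K L] {n : ℕ} (hn : 1 ≤ n) {N : ℕ}
    (a m : Fin N → ℤ) {z : Fin N → L} (h₀ : ∀ i, z i ≠ 0) (f : Tensor K N) :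
    ev n m z (yMonomial K n a f) = (∏ i, z i ^ (-a i)) * ev n m z f := by
  induction f using Finsupp.induction_linear with
  | zero => simp
  | add f g hf hg => rw [map_add, map_add, hf, hg, map_add, mul_add]
  | single l c =>
    rw [yMonomial, Finsupp.lmapDomain_apply, Finsupp.mapDomain_single, ev_single, ev_single,
      mul_smul_comm, evBasis, evBasis, ← Finset.prod_mul_distrib]
    congr 1
    refine Finset.prod_congr rfl fun i _ => ?_
    rw [evFactor, evFactor, vIndex_add_mul, zExponent_add_mul hn, mul_ite, mul_zero,
      sub_eq_neg_add, zpow_add₀ (h₀ i)]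

/-- The elementary symmetric polynomial `e_k(y_1^ε, …, y_N^ε)`. It is used for `ε = 1` and
`ε = -1`. -/
def esymmPow (K : Type*) [Field K] (n k : ℕ) (ε : ℤ) (N : ℕ) : Tensor K N →ₗ[K] Tensor K N :=
  ∑ S ∈ (Finset.univ : Finset (Fin N)).powersetCard k,
    yMonomial K n fun i => if i ∈ S then ε else 0

theorem ev_esymmPow {L : Type*} [Field L] [Algebra K L] {n : ℕ} (hn : 1 ≤ n) (k : ℕ) (ε : ℤ)
    {N : ℕ} (m : Fin N → ℤ) {z : Fin N → L} (h₀ : ∀ i, z i ≠ 0) (f : Tensor K N) :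
    ev n m z (esymmPow K n k ε N f) =
      (Finset.univ.val.map fun i => z i ^ (-ε)).esymm k * ev n m z f := by
  rw [Finset.esymm_map_val, esymmPow, LinearMap.sum_apply, map_sum, Finset.sum_mul]
  refine Finset.sum_congr rfl fun S _ => ?_
  rw [ev_yMonomial hn _ m h₀]
  congr 1
  rw [← Finset.prod_subset S.subset_univ fun i _ hi => by simp [hi]]
  exact Finset.prod_congr rfl fun i hi => by simp [hi]

theorem heckeT_esymmPow (q : K) {n : ℕ} (hn : 1 ≤ n) (k : ℕ) (ε : ℤ) {N : ℕ} (i : ℕ)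
    (f : Tensor K N) :
    heckeT q n N i (esymmPow K n k ε N f) = esymmPow K n k ε N (heckeT q n N i f) := by
  by_cases hi : i + 1 < N
  · have symmetric : ∀ (σ : Equiv.Perm (Fin N)) (z : Fin N → LaurentField K N),
        (Finset.univ.val.map fun i => (z ∘ σ) i ^ (-ε)).esymm k =
          (Finset.univ.val.map fun i => z i ^ (-ε)).esymm k := fun σ z => by
      conv_rhs => rw [← Multiset.map_univ_val_equiv σ, Multiset.map_map]
      rfl
    refine eq_of_ev_eq n fun m z hz h₀ => ?_
    rw [ev_heckeT q hn hi _ m hz h₀, ev_esymmPow hn k ε m h₀, ev_heckeT q hn hi _ m hz h₀,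
      demazure_congr _ _ _ (fun m z _ h₀ => ev_esymmPow hn k ε m h₀ f) m hz h₀]
    exact demazure_symm_mul _ _ _ _ _ m z (symmetric _ z)
  · simp [heckeT_eq_zero q n hi]

theorem antisymmetrizer_comm (q : K) (n : ℕ) {N : ℕ} (X : Tensor K N →ₗ[K] Tensor K N)
    (hX : ∀ i f, heckeT q n N i (X f) = X (heckeT q n N i f)) (f : Tensor K N) :
    antisymmetrizer q n N (X f) = X (antisymmetrizer q n N f) := by
  have heckeWord_comm : ∀ (w : List ℕ) f, heckeWord q n N w (X f) = X (heckeWord q n N w f) := by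
    intro w
    induction w with
    | nil => exact fun f => rfl
    | cons i w ih =>
      intro f
      rw [heckeWord_cons, LinearMap.comp_apply, LinearMap.comp_apply, hX, ih]
  rw [antisymmetrizer, LinearMap.sum_apply, LinearMap.sum_apply, map_sum]
  exact Finset.sum_congr rfl fun σ _ => heckeWord_comm _ f

/-! ### Extension by a vacuum vector -/

theorem extend_single (N : ℕ) (l : Fin N → ℤ) (c : K) :
    extend K N (Finsupp.single l c) =
      Finsupp.single (Fin.snoc (α := fun _ => ℤ) l (-(N : ℤ))) c := by
  rw [extend, Finsupp.lmapDomain_apply, Finsupp.mapDomain_single]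

theorem place_castSucc (n : ℕ) {N : ℕ} (a b : Fin N) (l : Fin N → ℤ) (m m' : ℤ)
    (f : Laurent₂ K) :
    place n a.castSucc b.castSucc (Fin.snoc (α := fun _ => ℤ) l (-(N : ℤ))) m m' f =
      extend K N (place n a b l m m' f) := by
  induction f using Finsupp.induction_linear with
  | zero => simp
  | add f g hf hg => simp only [map_add, hf, hg]
  | single r c =>
    simp only [place, Finsupp.lmapDomain_apply, Finsupp.mapDomain_single, extend_single,
      Fin.snoc_update]

theorem heckeOnBasis_castSucc (q : K) (n : ℕ) {N : ℕ} (a b : Fin N) (l : Fin N → ℤ) :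
    heckeOnBasis q n a.castSucc b.castSucc (Fin.snoc (α := fun _ => ℤ) l (-(N : ℤ))) =
      extend K N (heckeOnBasis q n a b l) := by
  simp only [heckeOnBasis, Fin.snoc_castSucc, place_castSucc]
  split_ifs <;> simp only [map_add, map_smul, map_neg]

theorem heckeT_extend (q : K) (n : ℕ) {N i : ℕ} (hi : i + 1 < N) (f : Tensor K N) :
    heckeT q n (N + 1) i (extend K N f) = extend K N (heckeT q n N i f) := by
  rw [heckeT, heckeT, dif_pos hi, dif_pos (Nat.lt_succ_of_lt hi)]
  induction f using Finsupp.induction_linear with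
  | zero => simp
  | add f g hf hg => simp only [map_add, hf, hg]
  | single l c =>
    rw [extend_single, Finsupp.linearCombination_single, Finsupp.linearCombination_single,
      map_smul, ← heckeOnBasis_castSucc]
    rfl

theorem cosetSum_extend (q : K) (n : ℕ) {N i : ℕ} (hi : i < N) (f : Tensor K N) :
    cosetSum q n (N + 1) i (extend K N f) = extend K N (cosetSum q n N i f) := by
  induction i generalizing f with
  | zero => rfl
  | succ i ih =>
    simp only [cosetSum_succ_apply, map_add, heckeT_extend q n hi, ih (Nat.lt_of_succ_lt hi)]

theorem cosetProd_extend (q : K) (n : ℕ) {N i : ℕ} (hi : i ≤ N) (f : Tensor K N) :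
    cosetProd q n (N + 1) i (extend K N f) = extend K N (cosetProd q n N i f) := by
  induction i with
  | zero => rfl
  | succ i ih =>
    simp only [cosetProd_succ_apply, ih (Nat.le_of_succ_le hi), cosetSum_extend q n hi]

theorem antisymmetrizer_extend (q : K) (n : ℕ) {N : ℕ} (f : Tensor K N) :
    antisymmetrizer q n (N + 1) (extend K N f) =
      cosetSum q n (N + 1) N (extend K N (antisymmetrizer q n N f)) := by
  rw [antisymmetrizer_eq_cosetProd, antisymmetrizer_eq_cosetProd, ← cosetProd_extend q n le_rfl]
  rfl

theorem antisymmetrizer_extendBy_eq_zero (q : K) (n : ℕ) {N : ℕ} {f : Tensor K N}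
    (hf : antisymmetrizer q n N f = 0) (d : ℕ) :
    antisymmetrizer q n (N + d) (extendBy K N d f) = 0 := by
  induction d with
  | zero => exact hf
  | succ d ih =>
    have factor := antisymmetrizer_extend q n (extendBy K N d f)
    rwa [ih, map_zero, map_zero] at factor

theorem toFock_eq_zero {q : K} {n N : ℕ} {f : Tensor K N} (h : antisymmetrizer q n N f = 0) :
    toFock q n N f = 0 := by
  rw [toFock, LinearMap.comp_apply, LinearMap.comp_apply, (toWedge_eq_zero_iff q n f).2 h,
    map_zero, map_zero]

theorem toFock_extend (q : K) (n : ℕ) {N : ℕ} (f : Tensor K N) :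
    toFock q n (N + 1) (extend K N f) = toFock q n N f :=
  ((Submodule.Quotient.eq (limitRelations q n)).2 (Submodule.subset_span ⟨N, f, rfl⟩)).symm

/-! ### Straightening of two adjacent factors -/

theorem place_congr (n : ℕ) {N : ℕ} {a b : Fin N} {l l' : Fin N → ℤ}
    (h : Set.EqOn l l' {a, b}ᶜ) (m m' : ℤ) (f : Laurent₂ K) :
    place n a b l m m' f = place n a b l' m m' f := by
  unfold place
  congr 2
  funext r i
  by_cases hb : i = b
  · subst hb
    simp
  by_cases ha : i = a
  · subst ha
    simp [hb]
  simpa [ha, hb] using h (by simp [ha, hb])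

theorem place_self (n : ℕ) {N : ℕ} (a b : Fin N) (l : Fin N → ℤ) :
    place n a b l (vIndex n (l a)) (vIndex n (l b))
      (Finsupp.single (zExponent n (l a), zExponent n (l b)) (1 : K)) = Finsupp.single l 1 := by
  rw [place, Finsupp.lmapDomain_apply, Finsupp.mapDomain_single, vIndex_sub_mul_zExponent,
    vIndex_sub_mul_zExponent, Function.update_eq_self, Function.update_eq_self]

theorem place_swap (n : ℕ) {N : ℕ} (a b : Fin N) (l : Fin N → ℤ) :
    place n a b l (vIndex n (l b)) (vIndex n (l a))
      (Finsupp.single (zExponent n (l b), zExponent n (l a)) (1 : K)) =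
        Finsupp.single (l ∘ Equiv.swap a b) 1 := by
  rw [← place_self n a b (l ∘ Equiv.swap a b), place_congr n (eqOn_comp_swap l a b)]
  simp only [Function.comp_apply, Equiv.swap_apply_left, Equiv.swap_apply_right]

theorem dividedDifference_self (a : ℤ) : (dividedDifference a a : Laurent₂ K) = 0 := by
  simp [dividedDifference]

theorem dividedDifference_add_one (a : ℤ) :
    (dividedDifference (a + 1) a : Laurent₂ K) = Finsupp.single (a, a) 1 := by
  simp [dividedDifference]

theorem mulZ₁_single (r : ℤ × ℤ) (c : K) :
    mulZ₁ (Finsupp.single r c) = Finsupp.single (r.1 + 1, r.2) c := by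
  simp [mulZ₁]

theorem heckeOnBasis_of_eq (q : K) (n : ℕ) {N : ℕ} {a b : Fin N} {l : Fin N → ℤ}
    (h : l a = l b) : heckeOnBasis q n a b l = -Finsupp.single l 1 := by
  have self := place_self (K := K) n a b l
  rw [h] at self
  simp [heckeOnBasis, h, dividedDifference_self, self]

theorem vIndex_zExponent_cases {n : ℕ} (hn : 1 ≤ n) {l l' : ℤ} (hlt : l < l') (hgap : l' < l + n) :
    (vIndex n l < vIndex n l' ∧ zExponent n l' = zExponent n l) ∨
      (vIndex n l' < vIndex n l ∧ zExponent n l = zExponent n l' + 1) := by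
  have hl := vIndex_sub_mul_zExponent n l
  have hl' := vIndex_sub_mul_zExponent n l'
  obtain ⟨one_le, le_n⟩ := vIndex_mem_Icc hn l
  obtain ⟨one_le', le_n'⟩ := vIndex_mem_Icc hn l'
  generalize vIndex n l = m at *
  generalize vIndex n l' = m' at *
  generalize zExponent n l = r at *
  generalize zExponent n l' = r' at *
  have lower : -1 < r - r' := lt_of_mul_lt_mul_left (a := (n : ℤ)) (by linarith) (by lia)
  have upper : r - r' < 2 := lt_of_mul_lt_mul_left (a := (n : ℤ)) (by linarith) (by lia)
  obtain rfl | rfl : r' = r ∨ r = r' + 1 := by lia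
  · exact Or.inl ⟨by linarith, rfl⟩
  · exact Or.inr ⟨by linarith, rfl⟩

theorem heckeOnBasis_of_lt (q : K) {n : ℕ} (hn : 1 ≤ n) {N : ℕ} {a b : Fin N} {l : Fin N → ℤ}
    (hlt : l a < l b) (hgap : l b < l a + n) :
    heckeOnBasis q n a b l =
      (-q⁻¹) • Finsupp.single (l ∘ Equiv.swap a b) 1 + (q⁻¹ ^ 2 - 1) • Finsupp.single l 1 := by
  have self := place_self (K := K) n a b l
  rcases vIndex_zExponent_cases hn hlt hgap with ⟨hm, hr⟩ | ⟨hm, hr⟩ <;>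
    rw [hr] at self <;> simp only [heckeOnBasis]
  · rw [if_pos hm, place_swap, hr, dividedDifference_add_one, self]
  · rw [if_neg hm.not_gt, if_neg hm.ne', place_swap, hr, dividedDifference_add_one, mulZ₁_single,
      self]

theorem heckeOnBasis_of_gt (q : K) {n : ℕ} (hn : 1 ≤ n) {N : ℕ} {a b : Fin N} {l : Fin N → ℤ}
    (hlt : l b < l a) (hgap : l a < l b + n) :
    heckeOnBasis q n a b l = (-q⁻¹) • Finsupp.single (l ∘ Equiv.swap a b) 1 := by
  rcases vIndex_zExponent_cases hn hlt hgap with ⟨hm, hr⟩ | ⟨hm, hr⟩ <;> simp only [heckeOnBasis]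
  · rw [if_neg hm.not_gt, if_neg hm.ne', place_swap, hr, dividedDifference_self, map_zero,
      map_zero, smul_zero, add_zero]
  · rw [if_pos hm, place_swap, ← hr, dividedDifference_self, map_zero, smul_zero, add_zero]

/-! ### Vectors of the Fock space given by sequences -/

/-- `u_{J 0} ⊗ ⋯ ⊗ u_{J (N-1)}`, where only the first `N` terms of `J` matter. -/
def seqTensor (K : Type*) [Field K] (N : ℕ) (J : ℕ → ℤ) : Tensor K N :=
  Finsupp.single (fun i => J i) 1

/-- `u_{J 0} ∧_q ⋯ ∧_q u_{J (N-1)} ∧_q u_{-N} ∧_q u_{-N-1} ∧_q ⋯`. -/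
def seqFock (q : K) (n N : ℕ) (J : ℕ → ℤ) : FockSpace q n :=
  toFock q n N (seqTensor K N J)

/-- From position `N` on, the sequence `J` is that of the vacuum `u_0 ∧_q u_{-1} ∧_q ⋯`. -/
def IsVacuumFrom (N : ℕ) (J : ℕ → ℤ) : Prop := ∀ i, N ≤ i → J i = -(i : ℤ)

theorem seqFock_congr (q : K) (n : ℕ) {N : ℕ} {J J' : ℕ → ℤ} (h : ∀ i < N, J i = J' i) :
    seqFock q n N J = seqFock q n N J' := by
  rw [seqFock, seqTensor, show (fun i : Fin N => J i) = fun i : Fin N => J' i from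
    funext fun i => h i i.2]
  rfl

theorem extend_seqTensor {N : ℕ} {J : ℕ → ℤ} (h : J N = -(N : ℤ)) :
    extend K N (seqTensor K N J) = seqTensor K (N + 1) J := by
  rw [seqTensor, extend_single, seqTensor, ← h]
  congr 1
  exact Fin.snoc_init_self fun i : Fin (N + 1) => J i

theorem extendBy_seqTensor {N : ℕ} {J : ℕ → ℤ} (hJ : IsVacuumFrom N J) (d : ℕ) :
    extendBy K N d (seqTensor K N J) = seqTensor K (N + d) J := by
  induction d with
  | zero => rfl
  | succ d ih =>
    rw [extendBy, LinearMap.comp_apply, ih, extend_seqTensor (hJ _ (Nat.le_add_right _ _))]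
    rfl

theorem seqFock_succ (q : K) (n : ℕ) {N : ℕ} {J : ℕ → ℤ} (h : J N = -(N : ℤ)) :
    seqFock q n (N + 1) J = seqFock q n N J := by
  rw [seqFock, ← extend_seqTensor h, toFock_extend]
  rfl

theorem seqFock_add (q : K) (n : ℕ) {N : ℕ} {J : ℕ → ℤ} (h : IsVacuumFrom N J) (d : ℕ) :
    seqFock q n (N + d) J = seqFock q n N J := by
  induction d with
  | zero => rfl
  | succ d ih => rw [← add_assoc, seqFock_succ q n (h _ (Nat.le_add_right _ _)), ih]

theorem heckeT_seqTensor (q : K) (n : ℕ) {N t : ℕ} (ht : t + 1 < N) (J : ℕ → ℤ) :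
    heckeT q n N t (seqTensor K N J) =
      heckeOnBasis q n ⟨t, Nat.lt_of_succ_lt ht⟩ ⟨t + 1, ht⟩ fun i => J i := by
  rw [heckeT, dif_pos ht, seqTensor, Finsupp.linearCombination_single, one_smul]

theorem single_comp_swap {N t : ℕ} (ht : t + 1 < N) (J : ℕ → ℤ) :
    (Finsupp.single ((fun i : Fin N => J i) ∘
      Equiv.swap ⟨t, Nat.lt_of_succ_lt ht⟩ ⟨t + 1, ht⟩) 1 : Tensor K N) =
        seqTensor K N (J ∘ Equiv.swap t (t + 1)) := by
  rw [seqTensor]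
  congr 1
  funext i
  simp only [Function.comp_apply, Equiv.swap_apply_def, Fin.ext_iff]
  split_ifs <;> rfl

theorem heckeT_seqTensor_of_lt (q : K) {n : ℕ} (hn : 1 ≤ n) {N t : ℕ} (ht : t + 1 < N)
    {J : ℕ → ℤ} (hlt : J t < J (t + 1)) (hgap : J (t + 1) < J t + n) :
    heckeT q n N t (seqTensor K N J) =
      (-q⁻¹) • seqTensor K N (J ∘ Equiv.swap t (t + 1)) + (q⁻¹ ^ 2 - 1) • seqTensor K N J := by
  rw [heckeT_seqTensor q n ht, heckeOnBasis_of_lt q hn hlt hgap, single_comp_swap ht]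
  rfl

theorem heckeT_seqTensor_of_gt (q : K) {n : ℕ} (hn : 1 ≤ n) {N t : ℕ} (ht : t + 1 < N)
    {J : ℕ → ℤ} (hlt : J (t + 1) < J t) (hgap : J t < J (t + 1) + n) :
    heckeT q n N t (seqTensor K N J) = (-q⁻¹) • seqTensor K N (J ∘ Equiv.swap t (t + 1)) := by
  rw [heckeT_seqTensor q n ht, heckeOnBasis_of_gt q hn hlt hgap, single_comp_swap ht]

theorem seqFock_eq_zero_of_eq (q : K) {n : ℕ} (hn : 1 ≤ n) {N t : ℕ} (ht : t + 1 < N)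
    {J : ℕ → ℤ} (h : J t = J (t + 1)) : seqFock q n N J = 0 := by
  refine toFock_eq_zero (antisymmetrizer_eq_zero q hn ht ?_)
  rw [heckeT_seqTensor q n ht, heckeOnBasis_of_eq q n h]
  rfl

theorem seqFock_swap (q : K) {n : ℕ} (hn : 1 ≤ n) {N t : ℕ} (ht : t + 1 < N)
    {J : ℕ → ℤ} (hlt : J t < J (t + 1)) (hgap : J (t + 1) < J t + n) :
    seqFock q n N J = (-q⁻¹) • seqFock q n N (J ∘ Equiv.swap t (t + 1)) := by
  set J' := J ∘ Equiv.swap t (t + 1) with hJ'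
  have swap_swap : J' ∘ Equiv.swap t (t + 1) = J := funext fun i => by simp [hJ']
  have action : heckeT q n N t (seqTensor K N J) =
      (-q⁻¹) • seqTensor K N J' + (q⁻¹ ^ 2 - 1) • seqTensor K N J :=
    heckeT_seqTensor_of_lt q hn ht hlt hgap
  have action' : heckeT q n N t (seqTensor K N J') = (-q⁻¹) • seqTensor K N J := by
    rw [heckeT_seqTensor_of_gt q hn ht (by simpa [hJ']) (by simpa [hJ']), swap_swap]
  have vanish : toFock q n N (seqTensor K N J + q⁻¹ • seqTensor K N J') = 0 := by
    refine toFock_eq_zero (antisymmetrizer_eq_zero q hn ht ?_)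
    rw [map_add, map_smul, action, action']
    module
  rw [map_add, map_smul] at vanish
  rw [neg_smul]
  exact eq_neg_of_add_eq_zero_left vanish

/-! ### Straightening of sequences -/

/-- The number of pairs of positions in `s` at which `J` increases. -/
def noninversions {α : Type*} [LinearOrder α] (s : Finset ℕ) (J : ℕ → α) : ℕ :=
  ((s ×ˢ s).filter fun p => p.1 < p.2 ∧ J p.1 < J p.2).card

theorem swap_succ_lt_swap_succ {t i j : ℕ} (hij : i < j) (h : ¬(i = t ∧ j = t + 1)) :
    Equiv.swap t (t + 1) i < Equiv.swap t (t + 1) j := by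
  simp only [Equiv.swap_apply_def]
  grind

theorem swap_mem_iff {α : Type*} [DecidableEq α] {s : Finset α} {a b : α} (ha : a ∈ s) (hb : b ∈ s)
    (i : α) : Equiv.swap a b i ∈ s ↔ i ∈ s := by
  rw [Equiv.swap_apply_def]
  split_ifs <;> simp_all

theorem image_comp_swap {α β : Type*} [DecidableEq α] [DecidableEq β] {s : Finset α} {a b : α}
    (ha : a ∈ s) (hb : b ∈ s) (J : α → β) : s.image (J ∘ Equiv.swap a b) = s.image J := by
  rw [← Finset.image_image]
  congr 1
  ext i
  rw [Finset.mem_image]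
  refine ⟨?_, fun hi =>
    ⟨Equiv.swap a b i, (swap_mem_iff ha hb i).2 hi, Equiv.swap_apply_self a b i⟩⟩
  rintro ⟨j, hj, rfl⟩
  exact (swap_mem_iff ha hb j).2 hj

theorem noninversions_swap {α : Type*} [LinearOrder α] {s : Finset ℕ} {t : ℕ} (ht : t ∈ s)
    (ht' : t + 1 ∈ s) {J : ℕ → α} (h : J t < J (t + 1)) :
    noninversions s (J ∘ Equiv.swap t (t + 1)) + 1 = noninversions s J := by
  set σ := Equiv.swap t (t + 1) with hσ
  have σσ : ∀ i, σ (σ i) = i := Equiv.swap_apply_self t (t + 1)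
  have mem : (t, t + 1) ∈ (s ×ˢ s).filter fun p => p.1 < p.2 ∧ J p.1 < J p.2 := by simp [*]
  rw [noninversions, noninversions, ← Finset.card_erase_add_one mem]
  congr 1
  refine Finset.card_equiv (Equiv.prodCongr σ σ) fun ⟨i, j⟩ => ?_
  simp only [Finset.mem_erase, Finset.mem_filter, Finset.mem_product, Equiv.prodCongr_apply,
    Prod.map, Function.comp_apply, ne_eq, Prod.mk.injEq, hσ, swap_mem_iff ht ht']
  simp only [← hσ]
  refine ⟨fun ⟨hmem, hlt, hJ⟩ => ?_, fun ⟨hne, hmem, hlt, hJ⟩ => ?_⟩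
  · have hne : ¬(i = t ∧ j = t + 1) := by
      rintro ⟨rfl, rfl⟩
      simp only [hσ, Equiv.swap_apply_left, Equiv.swap_apply_right] at hJ
      exact hJ.not_gt h
    refine ⟨fun ⟨hi, hj⟩ => ?_, hmem, swap_succ_lt_swap_succ hlt hne, hJ⟩
    rw [← σσ i, ← σσ j, hi, hj, hσ, Equiv.swap_apply_left, Equiv.swap_apply_right] at hlt
    exact hlt.not_gt (Nat.lt_succ_self t)
  · have hij := swap_succ_lt_swap_succ hlt hne
    rw [← hσ, σσ, σσ] at hij
    exact ⟨hmem, hij, hJ⟩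

/-- Any two entries of `J` at positions in `s` that are not decreasing differ by less than `n`;
such a sequence is straightened by two-term relations only. -/
def IsClose (n : ℕ) (s : Finset ℕ) (J : ℕ → ℤ) : Prop :=
  ∀ i ∈ s, ∀ j ∈ s, i < j → J i ≤ J j → J j < J i + n

theorem IsClose.swap {n : ℕ} {s : Finset ℕ} {t : ℕ} {J : ℕ → ℤ} (hJ : IsClose n s J) (ht : t ∈ s)
    (ht' : t + 1 ∈ s) (h : J t ≤ J (t + 1)) : IsClose n s (J ∘ Equiv.swap t (t + 1)) := by
  intro i hi j hj hij hle
  by_cases hadj : i = t ∧ j = t + 1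
  · obtain ⟨rfl, rfl⟩ := hadj
    have gap := hJ i hi (i + 1) hj hij h
    simp only [Function.comp_apply, Equiv.swap_apply_left, Equiv.swap_apply_right] at hle ⊢
    lia
  · exact hJ _ ((swap_mem_iff ht ht' i).2 hi) _ ((swap_mem_iff ht ht' j).2 hj)
      (swap_succ_lt_swap_succ hij hadj) hle

theorem exists_le_succ_of_not_strictAntiOn {α : Type*} [LinearOrder α] {s : Finset ℕ}
    (hs : (s : Set ℕ).OrdConnected) {J : ℕ → α} (hJ : ¬StrictAntiOn J s) :
    ∃ t ∈ s, t + 1 ∈ s ∧ J t ≤ J (t + 1) := by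
  by_contra! hdec
  exact hJ (strictAntiOn_of_add_one_lt hs fun t _ ht ht' => hdec t ht ht')

theorem seqFock_eq_zero (q : K) {n : ℕ} (hn : 1 ≤ n) {N : ℕ} {s : Finset ℕ}
    (hs : (s : Set ℕ).OrdConnected) (hsN : s ⊆ Finset.range N) {J : ℕ → ℤ} (hJ : IsClose n s J)
    (hinj : ¬Set.InjOn J s) : seqFock q n N J = 0 := by
  induction hm : noninversions s J using Nat.strong_induction_on generalizing J with
  | h m ih =>
    obtain ⟨t, ht, ht', hle⟩ :=
      exists_le_succ_of_not_strictAntiOn hs fun hanti => hinj hanti.injOn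
    have htN : t + 1 < N := Finset.mem_range.1 (hsN ht')
    rcases hle.eq_or_lt with heq | hlt
    · exact seqFock_eq_zero_of_eq q hn htN heq
    · rw [seqFock_swap q hn htN hlt (hJ t ht (t + 1) ht' (Nat.lt_succ_self t) hle),
        ih _ ?_ (hJ.swap ht ht' hle) ?_ rfl, smul_zero]
      · rw [← hm, ← noninversions_swap ht ht' hlt]
        exact Nat.lt_succ_self _
      · rwa [← Finset.card_image_iff, image_comp_swap ht ht', Finset.card_image_iff]

theorem noninversions_eq_zero {α : Type*} [LinearOrder α] {s : Finset ℕ} {J : ℕ → α}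
    (hJ : StrictAntiOn J s) : noninversions s J = 0 := by
  rw [noninversions, Finset.card_eq_zero, Finset.filter_eq_empty_iff]
  rintro ⟨i, j⟩ hij ⟨hlt, hJlt⟩
  rw [Finset.mem_product] at hij
  exact hJlt.not_gt (hJ hij.1 hij.2 hlt)

theorem eq_of_strictAntiOn_of_image_eq {α : Type*} [LinearOrder α] {M : ℕ} {J B : ℕ → α}
    (hJ : StrictAntiOn J (Finset.range M)) (hB : StrictAntiOn B (Finset.range M))
    (h : (Finset.range M).image J = (Finset.range M).image B) : ∀ i < M, J i = B i := by
  have strictAnti : ∀ {F : ℕ → α}, StrictAntiOn F (Finset.range M) →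
      StrictAnti fun i : Fin M => F i := fun hF i j hij => hF (by simp) (by simp) hij
  have range_eq : ∀ F : ℕ → α, Set.range (fun i : Fin M => F i) = (Finset.range M).image F :=
    fun F => by ext; simp [Fin.exists_iff]
  have heq := (StrictAnti.range_inj (strictAnti hJ) (strictAnti hB)).1 <| by
    rw [range_eq, h, range_eq]
  exact fun i hi => congrFun heq ⟨i, hi⟩

theorem seqFock_straighten {q : K} (hq : q ≠ 0) {n : ℕ} (hn : 1 ≤ n) {M : ℕ} {J B : ℕ → ℤ}
    (hJ : IsClose n (Finset.range M) J) (hB : StrictAntiOn B (Finset.range M))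
    (h : (Finset.range M).image J = (Finset.range M).image B) :
    seqFock q n M J =
      ((-q) ^ (-(noninversions (Finset.range M) J : ℤ))) • seqFock q n M B := by
  induction hm : noninversions (Finset.range M) J using Nat.strong_induction_on
    generalizing J with
  | h m ih =>
    by_cases hanti : StrictAntiOn J (Finset.range M)
    · rw [seqFock_congr q n (eq_of_strictAntiOn_of_image_eq hanti hB h), ← hm,
        noninversions_eq_zero hanti]
      simp
    have hinj : Set.InjOn J (Finset.range M) := by
      rw [← Finset.card_image_iff, h, Finset.card_image_iff]
      exact hB.injOn
    obtain ⟨t, ht, ht', hle⟩ :=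
      exists_le_succ_of_not_strictAntiOn (by simp [Set.ordConnected_Iio]) hanti
    have hlt : J t < J (t + 1) := hle.lt_of_ne fun heq => (Nat.lt_succ_self t).ne (hinj ht ht' heq)
    have drop := noninversions_swap ht ht' hlt
    rw [seqFock_swap q hn (Finset.mem_range.1 ht') hlt
        (hJ t ht (t + 1) ht' (Nat.lt_succ_self t) hle),
      ih _ (by lia) (hJ.swap ht ht' hle) ((image_comp_swap ht ht' J).trans h) rfl, smul_smul,
      ← hm, ← drop]
    congr 1
    push_cast
    rw [neg_add, zpow_add₀ (neg_ne_zero.2 hq), zpow_neg_one, mul_comm, inv_neg]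

/-! ### Thermodynamic limits -/

theorem exists_seqTensor_eq_single {N : ℕ} (l : Fin N → ℤ) :
    ∃ J, IsVacuumFrom N J ∧ seqTensor K N J = Finsupp.single l 1 :=
  ⟨fun i => if h : i < N then l ⟨i, h⟩ else -(i : ℤ), fun _ hi => dif_neg hi.not_gt, by
    simp [seqTensor]⟩

theorem tensor_hom_ext {F : Type*} [AddCommGroup F] [Module K F] {N : ℕ}
    {φ ψ : Tensor K N →ₗ[K] F}
    (h : ∀ J, IsVacuumFrom N J → φ (seqTensor K N J) = ψ (seqTensor K N J)) : φ = ψ := by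
  refine Finsupp.lhom_ext' fun l => LinearMap.ext_ring ?_
  obtain ⟨J, hJ, hl⟩ := exists_seqTensor_eq_single (K := K) l
  change φ (Finsupp.single l 1) = ψ (Finsupp.single l 1)
  exact hl ▸ h J hJ

/-- The linear map out of the Fock space that is given by compatible linear maps on the tensor
powers of `V(z)`. -/
def fockLift {q : K} {n : ℕ} {F : Type*} [AddCommGroup F] [Module K F]
    (φ : (N : ℕ) → Tensor K N →ₗ[K] F)
    (hker : ∀ N f, antisymmetrizer q n N f = 0 → φ N f = 0)
    (hext : ∀ N f, φ (N + 1) (extend K N f) = φ N f) : FockSpace q n →ₗ[K] F :=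
  (limitRelations q n).liftQ
    (DirectSum.toModule K ℕ F fun N =>
      (LinearMap.ker (antisymmetrizer q n N)).liftQ (φ N) (hker N)) <| by
    refine Submodule.span_le.2 ?_
    rintro x ⟨N, w, rfl⟩
    rw [SetLike.mem_coe, LinearMap.mem_ker, map_sub, sub_eq_zero]
    refine (DirectSum.toModule_lof (M := fun N => QWedge q n N) K N (toWedge q n N w)).trans ?_
    refine .trans ?_ (DirectSum.toModule_lof (M := fun N => QWedge q n N) K (N + 1) _).symm
    exact (hext N w).symm

theorem fockLift_toFock {q : K} {n : ℕ} {F : Type*} [AddCommGroup F] [Module K F]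
    (φ : (N : ℕ) → Tensor K N →ₗ[K] F)
    (hker : ∀ N f, antisymmetrizer q n N f = 0 → φ N f = 0)
    (hext : ∀ N f, φ (N + 1) (extend K N f) = φ N f) (N : ℕ) (w : Tensor K N) :
    fockLift φ hker hext (toFock q n N w) = φ N w :=
  DirectSum.toModule_lof (M := fun N => QWedge q n N) K (φ := fun N =>
    (LinearMap.ker (antisymmetrizer q n N)).liftQ (φ N) (hker N)) N (toWedge q n N w)

theorem IsThermodynamicLimit.unique {q : K} {n : ℕ} {X : (N : ℕ) → Tensor K N →ₗ[K] Tensor K N}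
    {E E' : FockSpace q n →ₗ[K] FockSpace q n} (h : IsThermodynamicLimit q n X E)
    (h' : IsThermodynamicLimit q n X E') : E = E' := by
  refine Submodule.linearMap_qext _ (DirectSum.linearMap_ext K fun N => LinearMap.ext fun x => ?_)
  obtain ⟨w, rfl⟩ := Submodule.Quotient.mk_surjective _ x
  obtain ⟨d, hd, hd'⟩ := ((h N w).and (h' N w)).exists
  exact hd.symm.trans hd'

theorem exists_isThermodynamicLimit (q : K) (n : ℕ) (X : (N : ℕ) → Tensor K N →ₗ[K] Tensor K N)
    (hX : ∀ N i f, heckeT q n N i (X N f) = X N (heckeT q n N i f)) (d₀ : ℕ)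
    (hstable : ∀ N J, IsVacuumFrom N J → ∀ M, N + d₀ ≤ M →
      toFock q n (M + 1) (X (M + 1) (seqTensor K (M + 1) J)) =
        toFock q n M (X M (seqTensor K M J))) :
    ∃ E, IsThermodynamicLimit q n X E := by
  let φ (N : ℕ) : Tensor K N →ₗ[K] FockSpace q n :=
    toFock q n (N + d₀) ∘ₗ X (N + d₀) ∘ₗ extendBy K N d₀
  have φ_seqTensor : ∀ N J, IsVacuumFrom N J → ∀ M, N + d₀ ≤ M →
      φ N (seqTensor K N J) = toFock q n M (X M (seqTensor K M J)) := fun N J hJ M hM => by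
    induction M, hM using Nat.le_induction with
    | base => rw [← extendBy_seqTensor hJ]; rfl
    | succ M hM ih => rw [ih, hstable N J hJ M hM]
  have φ_ker : ∀ N f, antisymmetrizer q n N f = 0 → φ N f = 0 := fun N f hf => toFock_eq_zero <| by
    rw [LinearMap.comp_apply, antisymmetrizer_comm q n _ (hX _),
      antisymmetrizer_extendBy_eq_zero q n hf, map_zero]
  have φ_extend : ∀ N f, φ (N + 1) (extend K N f) = φ N f := fun N =>
    LinearMap.congr_fun <| tensor_hom_ext (φ := φ (N + 1) ∘ₗ extend K N) fun J hJ => by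
      rw [LinearMap.comp_apply, extend_seqTensor (hJ N le_rfl),
        φ_seqTensor (N + 1) J (fun i hi => hJ i (Nat.le_of_succ_le hi)) _ le_rfl,
        φ_seqTensor N J hJ (N + 1 + d₀) (by lia)]
  refine ⟨fockLift φ φ_ker φ_extend, fun N w => ?_⟩
  filter_upwards [Filter.eventually_ge_atTop d₀] with d hd
  rw [fockLift_toFock]
  refine LinearMap.congr_fun (tensor_hom_ext
    (φ := toFock q n (N + d) ∘ₗ X (N + d) ∘ₗ extendBy K N d) fun J hJ => ?_) w
  rw [φ_seqTensor N J hJ (N + d) (by lia), ← extendBy_seqTensor hJ]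
  rfl

/-! ### Elementary symmetric polynomials on sequences -/

/-- `J` with the entries at the positions in `S` increased by `n ε`: the effect of the monomial
`∏_{i ∈ S} y_i^ε`. -/
def shiftSeq (n : ℕ) (ε : ℤ) (S : Finset ℕ) (J : ℕ → ℤ) (i : ℕ) : ℤ :=
  if i ∈ S then J i + n * ε else J i

/-- The class of `e_k(y_1^ε, …, y_N^ε)` applied to `u_{J 0} ⊗ ⋯ ⊗ u_{J (N-1)}`. -/
def esymmFock (q : K) (n k : ℕ) (ε : ℤ) (N : ℕ) (J : ℕ → ℤ) : FockSpace q n :=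
  ∑ S ∈ (Finset.range N).powersetCard k, seqFock q n N (shiftSeq n ε S J)

theorem esymmPow_seqTensor (n k : ℕ) (ε : ℤ) (N : ℕ) (J : ℕ → ℤ) :
    esymmPow K n k ε N (seqTensor K N J) =
      ∑ S ∈ (Finset.range N).powersetCard k, seqTensor K N (shiftSeq n ε S J) := by
  rw [← Nat.Iio_eq_range, ← Fin.map_valEmbedding_univ, Finset.powersetCard_map, Finset.sum_map,
    esymmPow, LinearMap.sum_apply]
  refine Finset.sum_congr rfl fun S _ => ?_
  rw [yMonomial, seqTensor, Finsupp.lmapDomain_apply, Finsupp.mapDomain_single, seqTensor]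
  congr 1
  funext i
  have mem_map : (i : ℕ) ∈ (Finset.mapEmbedding Fin.valEmbedding).toEmbedding S ↔ i ∈ S :=
    Finset.mem_map' Fin.valEmbedding
  simp only [shiftSeq, mem_map]
  split_ifs <;> ring

theorem toFock_esymmPow_seqTensor (q : K) (n k : ℕ) (ε : ℤ) (N : ℕ) (J : ℕ → ℤ) :
    toFock q n N (esymmPow K n k ε N (seqTensor K N J)) = esymmFock q n k ε N J := by
  rw [esymmPow_seqTensor, map_sum]
  rfl

theorem IsThermodynamicLimit.apply_seqFock {q : K} {n k : ℕ} {ε : ℤ}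
    {E : FockSpace q n →ₗ[K] FockSpace q n} (hE : IsThermodynamicLimit q n (esymmPow K n k ε) E)
    {N : ℕ} {J : ℕ → ℤ} (hJ : IsVacuumFrom N J) :
    ∀ᶠ M in Filter.atTop, E (seqFock q n N J) = esymmFock q n k ε M J := by
  rw [← Filter.map_add_atTop_eq_nat N, Filter.eventually_map]
  filter_upwards [hE N (seqTensor K N J)] with d hd
  rw [add_comm, ← toFock_esymmPow_seqTensor, ← extendBy_seqTensor hJ, hd]
  rfl

theorem esymmFock_succ (q : K) (n k : ℕ) (ε : ℤ) {N : ℕ} {J : ℕ → ℤ} (hJ : J N = -(N : ℤ))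
    (h : ∀ S ⊆ Finset.range (N + 1), S.card = k → N ∈ S →
      seqFock q n (N + 1) (shiftSeq n ε S J) = 0) :
    esymmFock q n k ε (N + 1) J = esymmFock q n k ε N J := by
  refine (Finset.sum_subset_zero_on_sdiff
    (Finset.powersetCard_mono (Finset.range_subset_range.2 N.le_succ)) (fun S hS => ?_)
    fun S hS => ?_).symm
  · obtain ⟨hS, hS'⟩ := Finset.mem_sdiff.1 hS
    obtain ⟨hsub, hcard⟩ := Finset.mem_powersetCard.1 hS
    refine h S hsub hcard (by_contra fun hN => hS' ?_)
    rw [Finset.range_add_one, Finset.subset_insert_iff_of_notMem hN] at hsub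
    exact Finset.mem_powersetCard.2 ⟨hsub, hcard⟩
  · have hN : N ∉ S := fun hN => by
      simpa using (Finset.mem_powersetCard.1 hS).1 hN
    exact (seqFock_succ q n (by rw [shiftSeq, if_neg hN, hJ])).symm

theorem exists_notMem_mem_succ {n : ℕ} (hn : 1 ≤ n) {S : Finset ℕ} {N : ℕ}
    (h : N + n * S.card ∈ S) : ∃ u < S.card, N + n * u ∉ S ∧ N + n * (u + 1) ∈ S := by
  by_contra! hdown
  have all_mem : ∀ u ≤ S.card, N + n * u ∈ S := fun u hu =>
    Nat.decreasingInduction' (fun v hv _ hmem => by_contra fun hv' => hdown v hv hv' hmem) hu h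
  have hcard : (Finset.range (S.card + 1)).card ≤ S.card :=
    Finset.card_le_card_of_injOn (fun u => N + n * u)
      (fun u hu => all_mem u (Nat.lt_succ_iff.1 (Finset.mem_range.1 hu)))
      fun u _ v _ huv => Nat.eq_of_mul_eq_mul_left hn (Nat.add_left_cancel huv)
  simp at hcard

-- A bead deep in the vacuum that moves up by `n` hits a bead that stays.
theorem seqFock_shiftSeq_one_eq_zero (q : K) {n : ℕ} (hn : 1 ≤ n) {N₀ N : ℕ} {J : ℕ → ℤ}
    (hJ : IsVacuumFrom N₀ J) {S : Finset ℕ} (hN : N₀ + n * S.card ≤ N) (hNS : N ∈ S) :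
    seqFock q n (N + 1) (shiftSeq n 1 S J) = 0 := by
  obtain ⟨N', rfl⟩ := Nat.exists_eq_add_of_le hN
  rw [add_right_comm] at hNS ⊢
  obtain ⟨u, hu, hstay, hmove⟩ := exists_notMem_mem_succ hn hNS
  set a := N₀ + N' + n * u with ha
  have ha' : N₀ + N' + n * (u + 1) = a + n := by rw [ha]; ring
  have hle : a + n ≤ N₀ + N' + n * S.card := by rw [← ha']; gcongr; exact hu
  rw [ha'] at hmove
  refine seqFock_eq_zero q hn (s := Finset.Icc a (a + n)) (by simp [Set.ordConnected_Icc]) ?_ ?_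
    fun hinj => ?_
  · intro i hi
    rw [Finset.mem_range]
    have := (Finset.mem_Icc.1 hi).2
    lia
  · intro i hi j hj hij
    simp only [Finset.mem_Icc] at hi hj
    rw [shiftSeq, shiftSeq, hJ i (by lia), hJ j (by lia)]
    split_ifs <;> lia
  · have := @hinj a (by simp) (a + n) (by simp) (by
      rw [shiftSeq, shiftSeq, if_neg hstay, if_pos hmove, hJ _ (by lia), hJ _ (by lia)]
      push_cast
      ring)
    lia

-- A bead in the vacuum that moves down by `n` hits a bead of the infinite tail.
theorem seqFock_shiftSeq_neg_one_eq_zero (q : K) {n : ℕ} (hn : 1 ≤ n) {N₀ N : ℕ} {J : ℕ → ℤ}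
    (hJ : IsVacuumFrom N₀ J) (hN : N₀ ≤ N) {S : Finset ℕ} (hS : S ⊆ Finset.range (N + 1))
    (hNS : N ∈ S) : seqFock q n (N + 1) (shiftSeq n (-1) S J) = 0 := by
  have hout : ∀ i, N + 1 ≤ i → i ∉ S := fun i hi hiS => (Finset.mem_range.1 (hS hiS)).not_ge hi
  have tail : IsVacuumFrom (N + 1) (shiftSeq n (-1) S J) := fun i hi => by
    rw [shiftSeq, if_neg (hout i hi), hJ i (by lia)]
  rw [← seqFock_add q n tail n]
  refine seqFock_eq_zero q hn (s := Finset.Icc N (N + n)) (by simp [Set.ordConnected_Icc]) ?_ ?_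
    fun hinj => ?_
  · intro i hi
    rw [Finset.mem_range]
    have := (Finset.mem_Icc.1 hi).2
    lia
  · intro i hi j hj hij
    simp only [Finset.mem_Icc] at hi hj
    rw [tail j (by lia), shiftSeq, hJ i (by lia)]
    split_ifs <;> lia
  · have := @hinj N (by simp) (N + n) (by simp) (by
      rw [tail (N + n) (by lia), shiftSeq, if_pos hNS, hJ N hN]
      push_cast
      ring)
    lia

theorem exists_isThermodynamicLimit_one (q : K) {n : ℕ} (hn : 1 ≤ n) (k : ℕ) :
    ∃ E, IsThermodynamicLimit q n (esymmPow K n k 1) E := by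
  refine exists_isThermodynamicLimit q n _ (fun N => heckeT_esymmPow q hn k 1) (n * k)
    fun N J hJ M hM => ?_
  rw [toFock_esymmPow_seqTensor, toFock_esymmPow_seqTensor]
  refine esymmFock_succ q n k 1 (hJ M (by lia)) fun S _ hS hMS => ?_
  exact seqFock_shiftSeq_one_eq_zero q hn hJ (hS ▸ hM) hMS

theorem exists_isThermodynamicLimit_neg_one (q : K) {n : ℕ} (hn : 1 ≤ n) (k : ℕ) :
    ∃ E, IsThermodynamicLimit q n (esymmPow K n k (-1)) E := by
  refine exists_isThermodynamicLimit q n _ (fun N => heckeT_esymmPow q hn k (-1)) 0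
    fun N J hJ M hM => ?_
  rw [toFock_esymmPow_seqTensor, toFock_esymmPow_seqTensor]
  exact esymmFock_succ q n k (-1) (hJ M hM) fun S hS _ hMS =>
    seqFock_shiftSeq_neg_one_eq_zero q hn hJ hM hS hMS

/-! ### Bead configurations of partitions -/

/-- The number of elements of `X` greater than `c`. When `X` is the bead configuration of `λ`, the
cell `(i, i + c)` belongs to `λ` if and only if `i < countGT X c`. -/
def countGT (X : Finset ℤ) (c : ℤ) : ℕ := (X.filter (c < ·)).card

theorem countGT_le_card (X : Finset ℤ) (c : ℤ) : countGT X c ≤ X.card :=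
  Finset.card_filter_le X _

theorem countGT_lt_card {X : Finset ℤ} {c : ℤ} (hc : c ∈ X) : countGT X c < X.card :=
  Finset.card_lt_card (Finset.filter_ssubset.2 ⟨c, hc, lt_irrefl c⟩)

theorem countGT_antitone (X : Finset ℤ) : Antitone (countGT X) := fun _ _ h =>
  Finset.card_le_card (Finset.monotone_filter_right X fun _ _ => h.trans_lt)

theorem countGT_sub_one (X : Finset ℤ) (c : ℤ) :
    countGT X (c - 1) = countGT X c + if c ∈ X then 1 else 0 := by
  have hsplit : X.filter (c - 1 < ·) = X.filter (c < ·) ∪ X.filter (c = ·) := by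
    rw [← Finset.filter_or]
    exact Finset.filter_congr fun x _ => by omega
  rw [countGT, hsplit, Finset.card_union_of_disjoint
    (Finset.disjoint_filter.2 fun x _ h => h.ne), Finset.filter_eq, countGT]
  split_ifs <;> rfl

theorem countGT_lt_countGT {X : Finset ℤ} {c d : ℤ} (hd : d ∈ X) (h : c < d) :
    countGT X d < countGT X c := by
  have hstep := countGT_sub_one X d
  have hle := countGT_antitone X (show c ≤ d - 1 by omega)
  rw [if_pos hd] at hstep
  omega

theorem countGT_injOn (X : Finset ℤ) : Set.InjOn (countGT X) X :=
  StrictAntiOn.injOn fun _ _ _ hd h => countGT_lt_countGT hd h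

theorem countGT_injective : Function.Injective countGT := by
  intro X X' h
  ext c
  have hX := countGT_sub_one X c
  have hX' := countGT_sub_one X' c
  rw [h] at hX
  split_ifs at hX hX' <;> first | omega | tauto

theorem exists_countGT_eq {X : Finset ℤ} {r : ℕ} (hr : r < X.card) :
    ∃ x ∈ X, countGT X x = r := by
  have himage : X.image (countGT X) = Finset.range X.card := by
    refine Finset.eq_of_subset_of_card_le (Finset.image_subset_iff.2 fun x hx => ?_) ?_
    · exact Finset.mem_range.2 (countGT_lt_card hx)
    · rw [Finset.card_range, Finset.card_image_of_injOn (countGT_injOn X)]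
  exact Finset.mem_image.1 (himage ▸ Finset.mem_range.2 hr)

theorem countGT_le_countGT_add (X : Finset ℤ) (c : ℤ) (m : ℕ) :
    countGT X c ≤ countGT X (c + m) + m := by
  induction m with
  | zero => simp
  | succ m ih =>
    have hstep := countGT_sub_one X (c + (m + 1 : ℕ))
    rw [show c + ((m + 1 : ℕ) : ℤ) - 1 = c + m by push_cast; ring] at hstep
    split_ifs at hstep <;> omega

theorem countGT_eq_card {X : Finset ℤ} {c : ℤ} (h : ∀ x ∈ X, c < x) : countGT X c = X.card := by
  rw [countGT, Finset.filter_true_of_mem h]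

theorem neg_le_countGT {X : Finset ℤ} (hX : ∀ x ∈ X, -(X.card : ℤ) < x) {c : ℤ}
    (hc : -(X.card : ℤ) ≤ c) : -c ≤ countGT X c := by
  have hsplit := Finset.card_filter_add_card_filter_not (s := X) (c < ·)
  have hle : (X.filter (¬ c < ·)).card ≤ (Finset.Ioc (-(X.card : ℤ)) c).card :=
    Finset.card_le_card fun x hx => by
      obtain ⟨hxX, hxc⟩ := Finset.mem_filter.1 hx
      exact Finset.mem_Ioc.2 ⟨hX x hxX, not_lt.1 hxc⟩
  rw [Int.card_Ioc] at hle
  unfold countGT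
  omega

/-- The position `λ_{i+1} - i` of the `i`-th bead of `λ`, that is, the index of the `i`-th factor
of the wedge `|λ⟩`. -/
def bead (lam : YoungDiagram) (i : ℕ) : ℤ := (lam.rowLen i : ℤ) - i

/-- The bead configuration of `λ`, truncated to its first `M` beads. -/
def beads (lam : YoungDiagram) (M : ℕ) : Finset ℤ := (Finset.range M).image (bead lam)

theorem bead_strictAnti (lam : YoungDiagram) : StrictAnti (bead lam) := fun i j h => by
  have := lam.rowLen_anti i j h.le
  unfold bead
  omega

theorem bead_mem_beads (lam : YoungDiagram) {M i : ℕ} (hi : i < M) : bead lam i ∈ beads lam M :=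
  Finset.mem_image_of_mem _ (Finset.mem_range.2 hi)

theorem card_beads (lam : YoungDiagram) (M : ℕ) : (beads lam M).card = M := by
  rw [beads, Finset.card_image_of_injective _ (bead_strictAnti lam).injective, Finset.card_range]

theorem neg_lt_of_mem_beads {lam : YoungDiagram} {M : ℕ} {x : ℤ} (hx : x ∈ beads lam M) :
    -(M : ℤ) < x := by
  obtain ⟨i, hi, rfl⟩ := Finset.mem_image.1 hx
  have := Finset.mem_range.1 hi
  unfold bead
  omega

theorem isVacuumFrom_bead {lam : YoungDiagram} {M : ℕ} (hM : lam.colLen 0 ≤ M) :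
    IsVacuumFrom M (bead lam) := by
  intro i hi
  have hrow : ¬ 0 < lam.rowLen i := by
    rw [← YoungDiagram.mem_iff_lt_rowLen, YoungDiagram.mem_iff_lt_colLen]
    omega
  unfold bead
  omega

theorem countGT_bead (lam : YoungDiagram) {M i : ℕ} (hi : i < M) :
    countGT (beads lam M) (bead lam i) = i := by
  rw [countGT, beads, Finset.filter_image,
    Finset.card_image_of_injective _ (bead_strictAnti lam).injective]
  simp only [(bead_strictAnti lam).lt_iff_gt]
  rw [show ((Finset.range M).filter (· < i)) = Finset.range i by ext j; simp; omega,
    Finset.card_range]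

theorem lt_countGT_beads_iff (lam : YoungDiagram) {M i : ℕ} (hi : i < M) (c : ℤ) :
    i < countGT (beads lam M) c ↔ c < bead lam i := by
  have hcount := countGT_bead lam hi
  refine ⟨fun h => not_le.1 fun hle => ?_, fun h => ?_⟩
  · have := countGT_antitone (beads lam M) hle
    omega
  · have := countGT_lt_countGT (bead_mem_beads lam hi) h
    omega

theorem countGT_beads_mono {lam mu : YoungDiagram} (h : lam ≤ mu) (M : ℕ) (d : ℤ) :
    countGT (beads lam M) d ≤ countGT (beads mu M) d := by
  refine le_of_forall_lt fun i hi => ?_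
  have hiM : i < M := hi.trans_le ((countGT_le_card _ _).trans (card_beads lam M).le)
  have hrow : lam.rowLen i ≤ mu.rowLen i := le_of_forall_lt fun j hj =>
    YoungDiagram.mem_iff_lt_rowLen.1 (h (YoungDiagram.mem_iff_lt_rowLen.2 hj))
  rw [lt_countGT_beads_iff _ hiM] at hi ⊢
  refine hi.trans_le ?_
  unfold bead
  omega

theorem lt_of_mem_of_colLen_le {lam : YoungDiagram} {M : ℕ} (hM : lam.colLen 0 ≤ M) {i j : ℕ}
    (h : (i, j) ∈ lam) : i < M :=
  (YoungDiagram.mem_iff_lt_colLen.1 (lam.up_left_mem le_rfl (Nat.zero_le j) h)).trans_le hM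

theorem mem_iff_lt_countGT {lam : YoungDiagram} {M : ℕ} (hM : lam.colLen 0 ≤ M) (i j : ℕ) :
    (i, j) ∈ lam ↔ i < countGT (beads lam M) ((j : ℤ) - i) := by
  by_cases hi : i < M
  · rw [lt_countGT_beads_iff lam hi, YoungDiagram.mem_iff_lt_rowLen, bead]
    omega
  · have hcard := countGT_le_card (beads lam M) ((j : ℤ) - i)
    rw [card_beads] at hcard
    exact iff_of_false (fun h => hi (lt_of_mem_of_colLen_le hM h)) (by omega)

theorem ext_of_beads_eq {lam mu : YoungDiagram} {M : ℕ} (hlam : lam.colLen 0 ≤ M)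
    (hmu : mu.colLen 0 ≤ M) (h : beads lam M = beads mu M) : lam = mu := by
  ext ⟨i, j⟩
  rw [YoungDiagram.mem_cells, YoungDiagram.mem_cells, mem_iff_lt_countGT hlam,
    mem_iff_lt_countGT hmu, h]

/-- The diagram with the bead configuration `X`, described diagonal by diagonal; the intended
configurations are those contained in `(-|X|, ∞)`. -/
def ofBeads (X : Finset ℤ) : YoungDiagram where
  cells := (Finset.range X.card ×ˢ Finset.range (X.sup Int.toNat + X.card)).filter
    fun p => p.1 < countGT X ((p.2 : ℤ) - p.1)
  isLowerSet := by
    rintro ⟨i, j⟩ ⟨i', j'⟩ hle h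
    obtain ⟨hi, hj⟩ : i' ≤ i ∧ j' ≤ j := hle
    simp only [Finset.coe_filter, Finset.mem_product, Finset.mem_range, Set.mem_ofPred_eq] at h ⊢
    refine ⟨⟨by omega, by omega⟩, ?_⟩
    have hshift := countGT_le_countGT_add X ((j : ℤ) - i) (i - i')
    have hanti := countGT_antitone X (show (j' : ℤ) - i' ≤ (j : ℤ) - i + (i - i' : ℕ) by omega)
    omega

theorem mem_ofBeads {X : Finset ℤ} {i j : ℕ} :
    (i, j) ∈ ofBeads X ↔ i < countGT X ((j : ℤ) - i) := by
  rw [← YoungDiagram.mem_cells]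
  simp only [ofBeads, Finset.mem_filter, Finset.mem_product, Finset.mem_range,
    and_iff_right_iff_imp]
  intro h
  obtain ⟨x, hx⟩ := Finset.card_pos.1 (Nat.zero_lt_of_lt h)
  obtain ⟨hxX, hjx⟩ := Finset.mem_filter.1 hx
  have hcard := countGT_le_card X ((j : ℤ) - i)
  have hsup := Finset.le_sup (f := Int.toNat) hxX
  omega

theorem colLen_ofBeads_le (X : Finset ℤ) : (ofBeads X).colLen 0 ≤ X.card := by
  by_contra! h
  exact (mem_ofBeads.1 (YoungDiagram.mem_iff_lt_colLen.2 h)).not_ge (countGT_le_card _ _)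

theorem beads_ofBeads {X : Finset ℤ} (hX : ∀ x ∈ X, -(X.card : ℤ) < x) :
    beads (ofBeads X) X.card = X := by
  refine countGT_injective (funext fun c => eq_of_forall_lt_iff fun i => ?_)
  by_cases hi : i < X.card
  · rcases le_or_gt 0 (c + i) with hc | hc
    · rw [lt_countGT_beads_iff _ hi, show c = ((c + i).toNat : ℤ) - i by omega, ← mem_ofBeads,
        YoungDiagram.mem_iff_lt_rowLen, bead]
      omega
    · refine iff_of_true ?_ ?_
      · rw [lt_countGT_beads_iff _ hi, bead]
        omega
      · rcases le_total (-(X.card : ℤ)) c with hcX | hcX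
        · have := neg_le_countGT hX hcX
          omega
        · rwa [countGT_eq_card fun x hx => hcX.trans_lt (hX x hx)]
  · have hbeads := countGT_le_card (beads (ofBeads X) X.card) c
    rw [card_beads] at hbeads
    have hcard := countGT_le_card X c
    exact iff_of_false (by omega) (by omega)

/-! ### Moving beads -/

/-- The configuration `X` after the beads in `Y` have been moved by `c`. -/
def move (c : ℤ) (X Y : Finset ℤ) : Finset ℤ := (X \ Y) ∪ Y.image (· + c)

/-- The beads `y ∈ Y` whose move to `y + n` passes the content `d`; their ribbons are those that
meet the diagonal of content `d`. -/
def active (n : ℕ) (Y : Finset ℤ) (d : ℤ) : Finset ℤ := Y.filter fun y => y ≤ d ∧ d < y + n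

theorem card_image_add (c : ℤ) (Y : Finset ℤ) : (Y.image (· + c)).card = Y.card :=
  Finset.card_image_of_injective _ (add_left_injective c)

theorem countGT_union {X Y : Finset ℤ} (h : Disjoint X Y) (d : ℤ) :
    countGT (X ∪ Y) d = countGT X d + countGT Y d := by
  rw [countGT, Finset.filter_union,
    Finset.card_union_of_disjoint (Finset.disjoint_filter_filter h), countGT, countGT]

theorem countGT_image_add (n : ℕ) (Y : Finset ℤ) (d : ℤ) :
    countGT (Y.image (· + (n : ℤ))) d = countGT Y d + (active n Y d).card := by
  unfold countGT active
  rw [Finset.filter_image, card_image_add, ← Finset.card_union_of_disjoint, ← Finset.filter_or]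
  · exact congrArg _ (Finset.filter_congr fun y _ => by omega)
  · exact Finset.disjoint_filter.2 fun y _ h => by omega

theorem countGT_sdiff_add_image {n : ℕ} {X Y : Finset ℤ} (hY : Y ⊆ X) (d : ℤ) :
    countGT (X \ Y) d + countGT (Y.image (· + (n : ℤ))) d =
      countGT X d + (active n Y d).card := by
  have hX := countGT_union (X := X \ Y) (Y := Y) Finset.sdiff_disjoint d
  rw [Finset.sdiff_union_of_subset hY] at hX
  rw [countGT_image_add, hX, add_assoc]

theorem disjoint_of_card_move {c : ℤ} {X Y : Finset ℤ} (hY : Y ⊆ X)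
    (h : (move c X Y).card = X.card) : Disjoint (X \ Y) (Y.image (· + c)) := by
  rw [← Finset.card_union_eq_card_add_card, card_image_add, Finset.card_sdiff_add_card_eq_card hY]
  exact h

theorem countGT_move {n : ℕ} {X Y : Finset ℤ} (hY : Y ⊆ X)
    (h : (move n X Y).card = X.card) (d : ℤ) :
    countGT (move n X Y) d = countGT X d + (active n Y d).card := by
  rw [move, countGT_union (disjoint_of_card_move hY h), countGT_sdiff_add_image hY]

theorem eq_move_of_countGT {n : ℕ} {X Y X' : Finset ℤ} (hY : Y ⊆ X)
    (h : ∀ d, countGT X' d = countGT X d + (active n Y d).card) : move n X Y = X' := by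
  ext d
  have hd := h d
  have hpred := h (d - 1)
  rw [← countGT_sdiff_add_image hY] at hd hpred
  rw [countGT_sub_one, countGT_sub_one (X \ Y), countGT_sub_one (Y.image _)] at hpred
  rw [move, Finset.mem_union]
  split_ifs at hpred <;> first | omega | tauto

/-! ### Ribbons as paths -/

/-- The cell on the diagonal of content `d` in row `g d` of `λ`. The cells of the conjugate
diagrams are used, so that the row number comes second and the content is `s - r` for the
cell `(s, r)`. -/
def pathCell (g : ℤ → ℕ) (d : ℤ) : ℕ × ℕ := ((g d + d).toNat, g d)

/-- `R` is the `n`-ribbon that meets the diagonals of contents `y, …, y + n - 1`, the diagonal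
of content `d` in the cell `pathCell g d`. -/
structure IsRibbonPath (n : ℕ) (y : ℤ) (g : ℤ → ℕ) (R : Finset (ℕ × ℕ)) : Prop where
  nonneg : ∀ d, y ≤ d → d < y + n → 0 ≤ (g d : ℤ) + d
  step : ∀ d, y ≤ d → d + 1 < y + n → g (d + 1) = g d ∨ g (d + 1) + 1 = g d
  eq_image : R = (Finset.range n).image fun t : ℕ => pathCell g (y + t)

namespace IsRibbonPath

variable {n : ℕ} {y y' : ℤ} {g g' : ℤ → ℕ} {R R' : Finset (ℕ × ℕ)}

theorem mem_iff (h : IsRibbonPath n y g R) {s r : ℕ} :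
    (s, r) ∈ R ↔ (y ≤ (s : ℤ) - r ∧ (s : ℤ) - r < y + n) ∧ r = g (s - r) := by
  rw [h.eq_image, Finset.mem_image]
  constructor
  · rintro ⟨t, ht, hcell⟩
    have ht := Finset.mem_range.1 ht
    have hnonneg := h.nonneg (y + t) (by omega) (by omega)
    obtain ⟨hs, hr⟩ := Prod.ext_iff.1 hcell
    simp only [pathCell] at hs hr
    rw [show (s : ℤ) - r = y + t by omega]
    omega
  · rintro ⟨hcontent, hr⟩
    refine ⟨((s : ℤ) - r - y).toNat, Finset.mem_range.2 (by omega), ?_⟩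
    rw [show y + (((s : ℤ) - r - y).toNat : ℤ) = s - r by omega, pathCell, ← hr]
    ext <;> simp

theorem content_pathCell (h : IsRibbonPath n y g R) {d : ℤ} (hyd : y ≤ d) (hdy : d < y + n) :
    ((pathCell g d).1 : ℤ) - (pathCell g d).2 = d := by
  have := h.nonneg d hyd hdy
  simp only [pathCell]
  omega

theorem pathCell_mem (h : IsRibbonPath n y g R) {d : ℤ} (hyd : y ≤ d) (hdy : d < y + n) :
    pathCell g d ∈ R := by
  rw [← Prod.mk.eta (p := pathCell g d), h.mem_iff, h.content_pathCell hyd hdy]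
  exact ⟨⟨hyd, hdy⟩, rfl⟩

theorem ext_row (h : IsRibbonPath n y g R) (h' : IsRibbonPath n y g' R')
    (hg : ∀ d, y ≤ d → d < y + n → g d = g' d) : R = R' := by
  ext ⟨s, r⟩
  rw [h.mem_iff, h'.mem_iff]
  exact and_congr_right fun hd => by rw [hg _ hd.1 hd.2]

theorem row_bounds (h : IsRibbonPath n y g R) {d : ℤ} (hyd : y ≤ d) :
    d < y + n → g d ≤ g y ∧ (g y : ℤ) + y ≤ g d + d := by
  induction d, hyd using Int.leInduction with
  | base => exact fun _ => ⟨le_rfl, le_rfl⟩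
  | succ d hyd ih =>
    intro hdy
    have := ih (by omega)
    have := h.step d hyd hdy
    omega

theorem isRibbon (h : IsRibbonPath n y g R) : IsRibbon n R := by
  refine ⟨fun t => pathCell g (y + t), fun t ht => ?_, h.eq_image⟩
  have hstep := h.step (y + t) (by omega) (by omega)
  have hnonneg := h.nonneg (y + t) (by omega) (by omega)
  have hnonneg' := h.nonneg (y + t + 1) (by omega) (by omega)
  simp only [pathCell]
  rw [show y + ((t + 1 : ℕ) : ℤ) = y + t + 1 by push_cast; ring]
  omega

theorem isInitialCell (h : IsRibbonPath n y g R) (hn : 1 ≤ n) :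
    IsInitialCell R (pathCell g y) := by
  refine ⟨h.pathCell_mem le_rfl (by omega), ?_⟩
  rintro ⟨s, r⟩ hsr
  obtain ⟨hd, hr⟩ := h.mem_iff.1 hsr
  have hbounds := h.row_bounds hd.1 hd.2
  simp only [pathCell]
  omega

theorem start_unique (h : IsRibbonPath n y g R) (h' : IsRibbonPath n y' g' R) (hn : 1 ≤ n) :
    y = y' := by
  have hle : ∀ {y y' : ℤ} {g g' : ℤ → ℕ}, IsRibbonPath n y g R → IsRibbonPath n y' g' R →
      y' ≤ y := fun {y y' g g'} h h' => by
    have hmem := h.pathCell_mem le_rfl (by omega)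
    rw [← Prod.mk.eta (p := pathCell g y), h'.mem_iff,
      h.content_pathCell le_rfl (by omega)] at hmem
    exact hmem.1.1
  exact le_antisymm (hle h' h) (hle h h')

end IsRibbonPath

theorem image_range_eq_Icc {f : ℕ → ℕ} {m : ℕ}
    (hf : ∀ t < m, f (t + 1) = f t ∨ f (t + 1) + 1 = f t) :
    (Finset.range (m + 1)).image f = Finset.Icc (f m) (f 0) ∧ f m ≤ f 0 := by
  induction m with
  | zero => simp
  | succ m ih =>
    obtain ⟨himage, hle⟩ := ih fun t ht => hf t (by omega)
    rw [Finset.range_add_one, Finset.image_insert, himage]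
    rcases hf m (by omega) with h | h
    · rw [h, Finset.insert_eq_self.2 (Finset.mem_Icc.2 ⟨le_rfl, hle⟩)]
      exact ⟨rfl, hle⟩
    · refine ⟨?_, by omega⟩
      ext x
      simp only [Finset.mem_insert, Finset.mem_Icc]
      omega

theorem IsRibbonPath.height_image_swap {n : ℕ} {y : ℤ} {g : ℤ → ℕ} {R : Finset (ℕ × ℕ)}
    (h : IsRibbonPath n y g R) (hn : 1 ≤ n) :
    height (R.image Prod.swap) + g (y + n - 1) = g y + 1 := by
  obtain ⟨m, rfl⟩ : ∃ m, n = m + 1 := ⟨n - 1, by omega⟩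
  have himage := image_range_eq_Icc (f := fun t => g (y + t)) (m := m) fun t ht => by
    have := h.step (y + t) (by omega) (by push_cast; omega)
    rwa [add_assoc] at this
  rw [height, h.eq_image, Finset.image_image, Finset.image_image]
  change ((Finset.range (m + 1)).image fun t : ℕ => g (y + t)).card + _ = _
  rw [himage.1, Nat.card_Icc, show y + ((m + 1 : ℕ) : ℤ) - 1 = y + m by push_cast; ring]
  have := himage.2
  simp only [Nat.cast_zero, add_zero] at this ⊢
  omega

theorem IsRibbon.exists_isRibbonPath {n : ℕ} {R : Finset (ℕ × ℕ)} (hR : IsRibbon n R)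
    {x : ℕ × ℕ} (hx : IsInitialCell R x) :
    ∃ g : ℤ → ℕ, IsRibbonPath n ((x.1 : ℤ) - x.2) g R ∧ g ((x.1 : ℤ) - x.2) = x.2 := by
  obtain ⟨c, hstep, rfl⟩ := hR
  have hcontent : ∀ t < n, ((c t).1 : ℤ) - (c t).2 = ((c 0).1 : ℤ) - (c 0).2 + t ∧
      (c 0).1 ≤ (c t).1 ∧ (c t).2 ≤ (c 0).2 := by
    intro t
    induction t with
    | zero => simp
    | succ t ih =>
      intro ht
      have := ih (by omega)
      have := hstep t ht
      push_cast
      omega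
  have hx0 : x = c 0 := by
    obtain ⟨t, ht, rfl⟩ := Finset.mem_image.1 hx.1
    have ht := Finset.mem_range.1 ht
    have hbounds := hcontent t ht
    have hinitial := hx.2 (c 0) (Finset.mem_image_of_mem c (Finset.mem_range.2 (by omega)))
    ext <;> omega
  subst hx0
  set y : ℤ := ((c 0).1 : ℤ) - (c 0).2
  have hrow : ∀ t : ℕ, (c (y + t - y).toNat).2 = (c t).2 := fun t => by
    rw [add_sub_cancel_left, Int.toNat_natCast]
  refine ⟨fun d => (c (d - y).toNat).2, ⟨fun d hyd hdy => ?_, fun d hyd hdy => ?_, ?_⟩, by simp⟩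
  · have := hcontent (d - y).toNat (by omega)
    omega
  · have := hstep (d - y).toNat (by omega)
    rw [show (d + 1 - y).toNat = (d - y).toNat + 1 by omega]
    omega
  · refine Finset.image_congr fun t ht => ?_
    have := hcontent t (Finset.mem_range.1 ht)
    simp only [pathCell, hrow]
    ext <;> simp only
    omega

/-! ### The ribbons traced out by moving beads -/

/-- The number of beads at rest in `(y, d]`: those that the bead `y` passes on its way to the
content `d`. -/
def passed (X Y : Finset ℤ) (y d : ℤ) : ℕ := ((X \ Y).filter fun x => y < x ∧ x ≤ d).card

/-- The row in which the ribbon of the bead `y` meets the diagonal of content `d`: the ribbons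
of the beads in `Y` are stacked on the boundary of the diagram in decreasing order of the
beads. -/
def ribbonRow (X Y : Finset ℤ) (y d : ℤ) : ℕ :=
  countGT X d + (Y.filter fun x => y < x ∧ x ≤ d).card

/-- The ribbon that is added when the beads in `Y` move by `n` and the bead `y ∈ Y` thereby
moves to `y + n`. -/
def ribbonAt (n : ℕ) (X Y : Finset ℤ) (y : ℤ) : Finset (ℕ × ℕ) :=
  (Finset.range n).image fun t : ℕ => pathCell (ribbonRow X Y y) (y + t)

theorem ribbonRow_add_passed {X Y : Finset ℤ} (hY : Y ⊆ X) {y d : ℤ} (hd : y ≤ d) :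
    ribbonRow X Y y d + passed X Y y d = countGT X y := by
  unfold ribbonRow passed countGT
  rw [add_assoc, ← Finset.card_union_of_disjoint
      (Finset.disjoint_filter_filter Finset.disjoint_sdiff), ← Finset.filter_union,
    Finset.union_sdiff_of_subset hY, ← Finset.card_union_of_disjoint
      (Finset.disjoint_filter.2 fun x _ h => by omega), ← Finset.filter_or]
  exact congrArg _ (Finset.filter_congr fun x _ => by omega)

theorem passed_add_one (X Y : Finset ℤ) (y d : ℤ) :
    passed X Y y (d + 1) = passed X Y y d ∨ passed X Y y (d + 1) = passed X Y y d + 1 := by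
  have hle : passed X Y y d ≤ passed X Y y (d + 1) :=
    Finset.card_le_card (Finset.monotone_filter_right _ fun x _ h => ⟨h.1, by omega⟩)
  have hsub : (X \ Y).filter (fun x => y < x ∧ x ≤ d + 1) ⊆
      insert (d + 1) ((X \ Y).filter fun x => y < x ∧ x ≤ d) := fun x hx => by
    simp only [Finset.mem_filter, Finset.mem_insert] at hx ⊢
    by_cases h : x = d + 1
    · exact Or.inl h
    · exact Or.inr ⟨hx.1, hx.2.1, by omega⟩
  have hge : passed X Y y (d + 1) ≤ passed X Y y d + 1 :=
    (Finset.card_le_card hsub).trans (Finset.card_insert_le _ _)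
  omega

theorem ribbonRow_self (X Y : Finset ℤ) (y : ℤ) : ribbonRow X Y y y = countGT X y := by
  unfold ribbonRow
  rw [Finset.filter_false_of_mem fun x _ => by omega, Finset.card_empty, add_zero]

theorem ribbonRow_eq_add_countGT_active {n : ℕ} {X Y : Finset ℤ} {y d : ℤ} (hd : d < y + n) :
    ribbonRow X Y y d = countGT X d + countGT (active n Y d) y := by
  unfold ribbonRow
  rw [countGT, countGT, active, Finset.filter_filter]
  exact congrArg _ (congrArg _ (Finset.filter_congr fun x _ => by omega))

section

variable {n M : ℕ} {lam mu : YoungDiagram} {Y : Finset ℤ}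

theorem isRibbonPath_ribbonAt (hY : Y ⊆ beads lam M) {y : ℤ} (hy : y ∈ Y) :
    IsRibbonPath n y (ribbonRow (beads lam M) Y y) (ribbonAt n (beads lam M) Y y) where
  nonneg d hyd _ := by
    have hlow := neg_lt_of_mem_beads (hY hy)
    have hcount := neg_le_countGT (X := beads lam M) (c := d)
      (fun x hx => by rw [card_beads]; exact neg_lt_of_mem_beads hx)
      (by rw [card_beads]; omega)
    unfold ribbonRow
    omega
  step d hyd _ := by
    have hd := ribbonRow_add_passed hY hyd
    have hsucc := ribbonRow_add_passed hY (show y ≤ d + 1 by omega)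
    have hpassed := passed_add_one (beads lam M) Y y d
    omega
  eq_image := rfl

theorem countGT_beads_of_move (hY : Y ⊆ beads lam M)
    (hmove : move n (beads lam M) Y = beads mu M) (d : ℤ) :
    countGT (beads mu M) d = countGT (beads lam M) d + (active n Y d).card := by
  rw [← hmove, countGT_move hY]
  rw [hmove, card_beads, card_beads]

theorem mem_skew_iff (hlam : lam.colLen 0 ≤ M) (hmu : mu.colLen 0 ≤ M) (s r : ℕ) :
    (s, r) ∈ mu.transpose.cells \ lam.transpose.cells ↔
      countGT (beads lam M) ((s : ℤ) - r) ≤ r ∧ r < countGT (beads mu M) ((s : ℤ) - r) := by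
  rw [Finset.mem_sdiff, YoungDiagram.mem_cells, YoungDiagram.mem_cells,
    YoungDiagram.mem_transpose, YoungDiagram.mem_transpose, Prod.swap_prod_mk,
    mem_iff_lt_countGT hlam, mem_iff_lt_countGT hmu]
  omega

theorem le_of_move (hlam : lam.colLen 0 ≤ M) (hmu : mu.colLen 0 ≤ M) (hY : Y ⊆ beads lam M)
    (hmove : move n (beads lam M) Y = beads mu M) : lam ≤ mu := by
  rintro ⟨i, j⟩ h
  have h := (mem_iff_lt_countGT hlam i j).1 h
  refine (mem_iff_lt_countGT hmu i j).2 ?_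
  rw [countGT_beads_of_move hY hmove]
  omega

theorem pairwiseDisjoint_ribbonAt (hY : Y ⊆ beads lam M) :
    (Y : Set ℤ).PairwiseDisjoint (ribbonAt n (beads lam M) Y) := by
  intro y hy y' hy' hne
  refine Finset.disjoint_left.2 ?_
  rintro ⟨s, r⟩ h h'
  obtain ⟨hd, hr⟩ := (isRibbonPath_ribbonAt hY hy).mem_iff.1 h
  obtain ⟨hd', hr'⟩ := (isRibbonPath_ribbonAt hY hy').mem_iff.1 h'
  rw [ribbonRow_eq_add_countGT_active hd.2] at hr
  rw [ribbonRow_eq_add_countGT_active hd'.2] at hr'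
  exact hne (countGT_injOn (active n Y ((s : ℤ) - r)) (Finset.mem_filter.2 ⟨hy, hd⟩)
    (Finset.mem_filter.2 ⟨hy', hd'⟩) (by omega))

theorem biUnion_ribbonAt (hlam : lam.colLen 0 ≤ M) (hmu : mu.colLen 0 ≤ M)
    (hY : Y ⊆ beads lam M) (hmove : move n (beads lam M) Y = beads mu M) :
    Y.biUnion (ribbonAt n (beads lam M) Y) = mu.transpose.cells \ lam.transpose.cells := by
  ext ⟨s, r⟩
  rw [mem_skew_iff hlam hmu, countGT_beads_of_move hY hmove, Finset.mem_biUnion]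
  constructor
  · rintro ⟨y, hy, h⟩
    obtain ⟨hd, hr⟩ := (isRibbonPath_ribbonAt hY hy).mem_iff.1 h
    rw [ribbonRow_eq_add_countGT_active hd.2] at hr
    have := countGT_lt_card (X := active n Y ((s : ℤ) - r)) (Finset.mem_filter.2 ⟨hy, hd⟩)
    omega
  · rintro ⟨hlow, hhigh⟩
    obtain ⟨y, hy, hcount⟩ := exists_countGT_eq (X := active n Y ((s : ℤ) - r))
      (r := r - countGT (beads lam M) ((s : ℤ) - r)) (by omega)
    obtain ⟨hy, hd⟩ := Finset.mem_filter.1 hy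
    refine ⟨y, hy, (isRibbonPath_ribbonAt hY hy).mem_iff.2 ⟨hd, ?_⟩⟩
    rw [ribbonRow_eq_add_countGT_active hd.2]
    omega

theorem ribbonAt_injective (hn : 1 ≤ n) {Y' : Finset ℤ} (hY : Y ⊆ beads lam M)
    (hY' : Y' ⊆ beads lam M) {y y' : ℤ} (hy : y ∈ Y) (hy' : y' ∈ Y')
    (h : ribbonAt n (beads lam M) Y y = ribbonAt n (beads lam M) Y' y') : y = y' :=
  (isRibbonPath_ribbonAt hY hy).start_unique (h ▸ isRibbonPath_ribbonAt hY' hy') hn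

theorem isHorizontalStripTiling_image_ribbonAt (hn : 1 ≤ n) (hlam : lam.colLen 0 ≤ M)
    (hmu : mu.colLen 0 ≤ M) (hY : Y ⊆ beads lam M) (hmove : move n (beads lam M) Y = beads mu M) :
    IsHorizontalStripTiling n Y.card mu.transpose lam.transpose
      (Y.image (ribbonAt n (beads lam M) Y)) where
  le := YoungDiagram.transpose_mono (le_of_move hlam hmu hY hmove)
  ribbon := Finset.forall_mem_image.2 fun _ hy => (isRibbonPath_ribbonAt hY hy).isRibbon
  disjoint := by
    rw [Finset.coe_image, Set.InjOn.pairwiseDisjoint_image fun _ hy _ hy' =>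
      ribbonAt_injective hn hY hY hy hy']
    exact pairwiseDisjoint_ribbonAt hY
  union := by
    rw [Finset.image_biUnion]
    exact biUnion_ribbonAt hlam hmu hY hmove
  card := Finset.card_image_of_injOn fun _ hy _ hy' => ribbonAt_injective hn hY hY hy hy'
  initial := Finset.forall_mem_image.2 fun y hy => by
    refine ⟨_, (isRibbonPath_ribbonAt hY hy).isInitialCell hn, ?_⟩
    obtain ⟨i, hi, rfl⟩ := Finset.mem_image.1 (hY hy)
    rw [pathCell, ribbonRow_self, countGT_bead lam (Finset.mem_range.1 hi),
      YoungDiagram.colLen_transpose, bead, add_sub_cancel, Int.toNat_natCast]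

theorem image_ribbonAt_injective (hn : 1 ≤ n) {Y' : Finset ℤ} (hY : Y ⊆ beads lam M)
    (hY' : Y' ⊆ beads lam M)
    (h : Y.image (ribbonAt n (beads lam M) Y) = Y'.image (ribbonAt n (beads lam M) Y')) :
    Y = Y' := by
  have hsub : ∀ {Y Y' : Finset ℤ}, Y ⊆ beads lam M → Y' ⊆ beads lam M →
      Y.image (ribbonAt n (beads lam M) Y) = Y'.image (ribbonAt n (beads lam M) Y') →
      Y ⊆ Y' := by
    intro Y Y' hY hY' h y hy
    obtain ⟨y', hy', heq⟩ := Finset.mem_image.1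
      (h ▸ Finset.mem_image_of_mem (ribbonAt n (beads lam M) Y) hy)
    rwa [← ribbonAt_injective hn hY' hY hy' hy heq]
  exact (hsub hY hY' h).antisymm (hsub hY' hY h.symm)

/-- The number of pairs consisting of a moved bead and a bead at rest that it passes. -/
def crossings (n : ℕ) (X Y : Finset ℤ) : ℕ :=
  (((X \ Y) ×ˢ Y).filter fun p : ℤ × ℤ => p.2 < p.1 ∧ p.1 < p.2 + n).card

theorem crossings_eq_sum_passed (n : ℕ) (X Y : Finset ℤ) :
    crossings n X Y = ∑ y ∈ Y, passed X Y y (y + n - 1) := by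
  unfold crossings passed
  rw [Finset.card_filter, Finset.sum_product_right]
  refine Finset.sum_congr rfl fun y _ => ?_
  rw [Finset.card_filter]
  exact Finset.sum_congr rfl fun x _ => if_congr (by omega) rfl rfl

theorem height_ribbonAt (hn : 1 ≤ n) (hY : Y ⊆ beads lam M) {y : ℤ} (hy : y ∈ Y) :
    height ((ribbonAt n (beads lam M) Y y).image Prod.swap) =
      passed (beads lam M) Y y (y + n - 1) + 1 := by
  have hheight := (isRibbonPath_ribbonAt (n := n) hY hy).height_image_swap hn
  have hpassed := ribbonRow_add_passed hY (show y ≤ y + n - 1 by omega)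
  rw [ribbonRow_self] at hheight
  omega

theorem twiceSpin_conjugate_image_ribbonAt (hn : 1 ≤ n) (hY : Y ⊆ beads lam M) :
    twiceSpin (conjugate (Y.image (ribbonAt n (beads lam M) Y))) =
      crossings n (beads lam M) Y := by
  rw [twiceSpin, conjugate, Finset.image_image, Finset.sum_image, crossings_eq_sum_passed]
  · refine Finset.sum_congr rfl fun y hy => ?_
    rw [Function.comp_apply, height_ribbonAt hn hY hy, Nat.add_sub_cancel]
  · intro y hy y' hy' h
    exact ribbonAt_injective hn hY hY hy hy' (Finset.image_injective Prod.swap_injective h)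

end

/-! ### Every horizontal ribbon strip is traced out by moving beads -/

/-- A horizontal `n`-ribbon strip `T` of shape `μ' / λ'`, where `λ` and `μ` have at most `M` rows,
whose ribbons `R` are parametrised as the ribbon paths `g R` that start at the beads `y R`
of `λ`. -/
structure IsParametrizedStrip (n k M : ℕ) (lam mu : YoungDiagram) (T : Finset (Finset (ℕ × ℕ)))
    (y : Finset (ℕ × ℕ) → ℤ) (g : Finset (ℕ × ℕ) → ℤ → ℕ) : Prop
    extends IsHorizontalStripTiling n k mu.transpose lam.transpose T where
  colLen_left : lam.colLen 0 ≤ M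
  colLen_right : mu.colLen 0 ≤ M
  path : ∀ R ∈ T, IsRibbonPath n (y R) (g R) R
  start_lt : ∀ R ∈ T, g R (y R) < M
  start_eq : ∀ R ∈ T, y R = bead lam (g R (y R))

/-- The ribbons of `T` that meet the diagonal of content `d`. -/
def ribbonsMeeting (n : ℕ) (T : Finset (Finset (ℕ × ℕ))) (y : Finset (ℕ × ℕ) → ℤ) (d : ℤ) :
    Finset (Finset (ℕ × ℕ)) :=
  T.filter fun R => y R ≤ d ∧ d < y R + n

theorem mem_ribbonsMeeting {n : ℕ} {T : Finset (Finset (ℕ × ℕ))} {y : Finset (ℕ × ℕ) → ℤ} {d : ℤ}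
    {R : Finset (ℕ × ℕ)} : R ∈ ribbonsMeeting n T y d ↔ R ∈ T ∧ y R ≤ d ∧ d < y R + n :=
  Finset.mem_filter

theorem image_ribbonsMeeting (n : ℕ) (T : Finset (Finset (ℕ × ℕ))) (y : Finset (ℕ × ℕ) → ℤ)
    (d : ℤ) : (ribbonsMeeting n T y d).image y = active n (T.image y) d := by
  rw [active, Finset.filter_image]
  rfl

theorem IsHorizontalStripTiling.exists_isParametrizedStrip {n k M : ℕ} {lam mu : YoungDiagram}
    {T : Finset (Finset (ℕ × ℕ))} (hT : IsHorizontalStripTiling n k mu.transpose lam.transpose T)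
    (hlam : lam.colLen 0 ≤ M) (hmu : mu.colLen 0 ≤ M) :
    ∃ y g, IsParametrizedStrip n k M lam mu T y g := by
  have hpath : ∀ R ∈ T, ∃ (y : ℤ) (g : ℤ → ℕ),
      IsRibbonPath n y g R ∧ g y < M ∧ y = bead lam (g y) := by
    intro R hR
    obtain ⟨x, hx, hxlam⟩ := hT.initial R hR
    obtain ⟨g, hg, hgx⟩ := (hT.ribbon R hR).exists_isRibbonPath hx
    have hmem : x ∈ mu.transpose.cells :=
      Finset.sdiff_subset (hT.union ▸ Finset.mem_biUnion.2 ⟨R, hR, hx.1⟩)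
    rw [YoungDiagram.mem_cells, YoungDiagram.mem_transpose] at hmem
    refine ⟨_, g, hg, hgx.trans_lt (lt_of_mem_of_colLen_le hmu hmem), ?_⟩
    rw [hgx, bead, hxlam, YoungDiagram.colLen_transpose]
  choose! y g hg using hpath
  exact ⟨y, g, hT, hlam, hmu, fun R hR => (hg R hR).1, fun R hR => (hg R hR).2.1,
    fun R hR => (hg R hR).2.2⟩

theorem eq_add_card_filter_lt {ι : Type*} {s : Finset ι} {f : ι → ℕ} {a b : ℕ}
    (hf : Set.InjOn f s) (himage : s.image f = Finset.Ico a b) {i : ι} (hi : i ∈ s) :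
    f i = a + (s.filter fun j => f j < f i).card := by
  have hmem := Finset.mem_Ico.1 (himage ▸ Finset.mem_image_of_mem f hi)
  have hlt : (Finset.Ico a b).filter (· < f i) = Finset.Ico a (f i) := by
    ext r
    simp only [Finset.mem_filter, Finset.mem_Ico]
    omega
  rw [← Finset.card_image_of_injOn (hf.mono (Finset.coe_subset.2 (Finset.filter_subset _ _))),
    ← Finset.filter_image (p := (· < f i)), himage, hlt, Nat.card_Ico]
  omega

namespace IsParametrizedStrip

variable {n k M : ℕ} {lam mu : YoungDiagram} {T : Finset (Finset (ℕ × ℕ))}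
  {y : Finset (ℕ × ℕ) → ℤ} {g : Finset (ℕ × ℕ) → ℤ → ℕ}

theorem row_injOn (h : IsParametrizedStrip n k M lam mu T y g) (d : ℤ) :
    Set.InjOn (fun R => g R d) (ribbonsMeeting n T y d) := by
  intro R hR R' hR' heq
  obtain ⟨hRT, hd⟩ := mem_ribbonsMeeting.1 hR
  obtain ⟨hRT', hd'⟩ := mem_ribbonsMeeting.1 hR'
  have hcell : pathCell (g R) d = pathCell (g R') d := by
    simp only at heq
    rw [pathCell, pathCell, heq]
  exact h.disjoint.elim_finset hRT hRT' _ ((h.path R hRT).pathCell_mem hd.1 hd.2)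
    (hcell ▸ (h.path R' hRT').pathCell_mem hd'.1 hd'.2)

theorem start_injOn (h : IsParametrizedStrip n k M lam mu T y g) (hn : 1 ≤ n) :
    Set.InjOn y T := by
  intro R hR R' hR' heq
  refine h.row_injOn (y R) (mem_ribbonsMeeting.2 ⟨hR, le_rfl, by omega⟩)
    (mem_ribbonsMeeting.2 ⟨hR', heq.ge, by omega⟩) ((bead_strictAnti lam).injective ?_)
  simp only
  rw [← h.start_eq R hR, heq, ← h.start_eq R' hR']

theorem start_injOn_ribbonsMeeting (h : IsParametrizedStrip n k M lam mu T y g) (hn : 1 ≤ n)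
    (d : ℤ) : Set.InjOn y (ribbonsMeeting n T y d) :=
  (h.start_injOn hn).mono (Finset.coe_subset.2 (Finset.filter_subset _ _))

theorem image_start_subset (h : IsParametrizedStrip n k M lam mu T y g) :
    T.image y ⊆ beads lam M :=
  Finset.image_subset_iff.2 fun R hR => by
    rw [h.start_eq R hR]
    exact bead_mem_beads lam (h.start_lt R hR)

theorem row_mem_Ico (h : IsParametrizedStrip n k M lam mu T y g) {R : Finset (ℕ × ℕ)} {d : ℤ}
    (hR : R ∈ ribbonsMeeting n T y d) :
    g R d ∈ Finset.Ico (countGT (beads lam M) d) (countGT (beads mu M) d) := by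
  obtain ⟨hRT, hyd, hdy⟩ := mem_ribbonsMeeting.1 hR
  have hcell : pathCell (g R) d ∈ mu.transpose.cells \ lam.transpose.cells :=
    h.union ▸ Finset.mem_biUnion.2 ⟨R, hRT, (h.path R hRT).pathCell_mem hyd hdy⟩
  rw [← Prod.mk.eta (p := pathCell (g R) d), mem_skew_iff h.colLen_left h.colLen_right,
    (h.path R hRT).content_pathCell hyd hdy] at hcell
  exact Finset.mem_Ico.2 hcell

theorem image_row (h : IsParametrizedStrip n k M lam mu T y g) (d : ℤ) :
    (ribbonsMeeting n T y d).image (fun R => g R d) =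
      Finset.Ico (countGT (beads lam M) d) (countGT (beads mu M) d) := by
  refine (Finset.image_subset_iff.2 fun R hR => h.row_mem_Ico hR).antisymm fun r hr => ?_
  have hskew := Finset.mem_Ico.1 hr
  have hmu := (countGT_le_card (beads mu M) d).trans (card_beads mu M).le
  have hd : -(M : ℤ) < d := by
    by_contra! hd
    rw [countGT_eq_card fun x hx => hd.trans_lt (neg_lt_of_mem_beads hx), card_beads] at hskew
    omega
  have hlow := neg_le_countGT (X := beads lam M) (c := d)
    (fun x hx => by rw [card_beads]; exact neg_lt_of_mem_beads hx)
    (by rw [card_beads]; exact hd.le)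
  have hcontent : (((r + d).toNat : ℕ) : ℤ) - r = d := by omega
  have hcell : ((r + d).toNat, r) ∈ mu.transpose.cells \ lam.transpose.cells := by
    rwa [mem_skew_iff h.colLen_left h.colLen_right, hcontent]
  rw [← h.union] at hcell
  obtain ⟨R, hR, hcell⟩ := Finset.mem_biUnion.1 hcell
  have hrow := (h.path R hR).mem_iff.1 hcell
  rw [hcontent] at hrow
  exact Finset.mem_image.2 ⟨R, mem_ribbonsMeeting.2 ⟨hR, hrow.1⟩, hrow.2.symm⟩

theorem move_eq (h : IsParametrizedStrip n k M lam mu T y g) (hn : 1 ≤ n) :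
    move n (beads lam M) (T.image y) = beads mu M := by
  refine eq_move_of_countGT h.image_start_subset fun d => ?_
  have hrows := congrArg Finset.card (h.image_row d)
  rw [Finset.card_image_of_injOn (h.row_injOn d), Nat.card_Ico] at hrows
  have hmono := countGT_beads_mono (YoungDiagram.transpose_le_iff.1 h.le) M d
  rw [← image_ribbonsMeeting, Finset.card_image_of_injOn (h.start_injOn_ribbonsMeeting hn d)]
  omega

-- The rows of two ribbons change by at most one from a diagonal to the next and never agree, so
-- their order on the first diagonal that both ribbons meet persists.
theorem row_lt_row (h : IsParametrizedStrip n k M lam mu T y g) {R R' : Finset (ℕ × ℕ)} {d : ℤ}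
    (hR : R ∈ ribbonsMeeting n T y d) (hR' : R' ∈ ribbonsMeeting n T y d) (hlt : y R < y R') :
    g R' d < g R d := by
  obtain ⟨hRT, -, hdy⟩ := mem_ribbonsMeeting.1 hR
  obtain ⟨hRT', hyd', hdy'⟩ := mem_ribbonsMeeting.1 hR'
  clear hR hR'
  induction d, hyd' using Int.leInduction with
  | base =>
    have hlow := (Finset.mem_Ico.1
      (h.row_mem_Ico (mem_ribbonsMeeting.2 ⟨hRT, hlt.le, hdy⟩))).1
    have hne : g R (y R') ≠ g R' (y R') := fun heq => hlt.ne
      (congrArg y (h.row_injOn _ (mem_ribbonsMeeting.2 ⟨hRT, hlt.le, hdy⟩)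
        (mem_ribbonsMeeting.2 ⟨hRT', le_rfl, hdy'⟩) heq))
    have hstart := countGT_bead lam (h.start_lt R' hRT')
    rw [← h.start_eq R' hRT'] at hstart
    omega
  | succ d hyd' ih =>
    have hne : g R (d + 1) ≠ g R' (d + 1) := fun heq => hlt.ne
      (congrArg y (h.row_injOn _ (mem_ribbonsMeeting.2 ⟨hRT, by omega, hdy⟩)
        (mem_ribbonsMeeting.2 ⟨hRT', by omega, hdy'⟩) heq))
    have := ih (by omega) (by omega)
    have := (h.path R hRT).step d (by omega) hdy
    have := (h.path R' hRT').step d hyd' hdy'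
    omega

theorem row_lt_row_iff (h : IsParametrizedStrip n k M lam mu T y g) (hn : 1 ≤ n)
    {R R' : Finset (ℕ × ℕ)} {d : ℤ} (hR : R ∈ ribbonsMeeting n T y d)
    (hR' : R' ∈ ribbonsMeeting n T y d) : g R' d < g R d ↔ y R < y R' := by
  refine ⟨fun hrow => ?_, h.row_lt_row hR hR'⟩
  rcases lt_trichotomy (y R) (y R') with hlt | heq | hlt
  · exact hlt
  · rw [h.start_injOn hn (mem_ribbonsMeeting.1 hR).1 (mem_ribbonsMeeting.1 hR').1 heq] at hrow
    exact absurd hrow (lt_irrefl _)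
  · exact absurd hrow (h.row_lt_row hR' hR hlt).not_gt

theorem row_eq_ribbonRow (h : IsParametrizedStrip n k M lam mu T y g) (hn : 1 ≤ n)
    {R : Finset (ℕ × ℕ)} {d : ℤ} (hR : R ∈ ribbonsMeeting n T y d) :
    g R d = ribbonRow (beads lam M) (T.image y) (y R) d := by
  have hbelow : countGT ((ribbonsMeeting n T y d).image y) (y R) =
      ((ribbonsMeeting n T y d).filter fun R' => g R' d < g R d).card := by
    rw [countGT, Finset.filter_image, Finset.card_image_of_injOn
      ((h.start_injOn_ribbonsMeeting hn d).mono (Finset.coe_subset.2 (Finset.filter_subset _ _)))]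
    exact congrArg _ (Finset.filter_congr fun R' hR' => (h.row_lt_row_iff hn hR hR').symm)
  rw [ribbonRow_eq_add_countGT_active (mem_ribbonsMeeting.1 hR).2.2, ← image_ribbonsMeeting,
    hbelow]
  exact eq_add_card_filter_lt (h.row_injOn d) (h.image_row d) hR

theorem ribbonAt_start (h : IsParametrizedStrip n k M lam mu T y g) (hn : 1 ≤ n)
    {R : Finset (ℕ × ℕ)} (hR : R ∈ T) :
    ribbonAt n (beads lam M) (T.image y) (y R) = R := by
  refine ((h.path R hR).ext_row
    (isRibbonPath_ribbonAt h.image_start_subset (Finset.mem_image_of_mem y hR))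
    fun d hyd hdy => ?_).symm
  exact h.row_eq_ribbonRow hn (mem_ribbonsMeeting.2 ⟨hR, hyd, hdy⟩)

end IsParametrizedStrip

theorem IsHorizontalStripTiling.exists_beads {n k M : ℕ} {lam mu : YoungDiagram}
    {T : Finset (Finset (ℕ × ℕ))} (hT : IsHorizontalStripTiling n k mu.transpose lam.transpose T)
    (hn : 1 ≤ n) (hlam : lam.colLen 0 ≤ M) (hmu : mu.colLen 0 ≤ M) :
    ∃ Y ⊆ beads lam M, Y.card = k ∧ move n (beads lam M) Y = beads mu M ∧
      Y.image (ribbonAt n (beads lam M) Y) = T := by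
  obtain ⟨y, g, h⟩ := hT.exists_isParametrizedStrip hlam hmu
  refine ⟨T.image y, h.image_start_subset, ?_, h.move_eq hn, ?_⟩
  · rw [Finset.card_image_of_injOn (h.start_injOn hn), hT.card]
  · rw [Finset.image_image]
    exact (Finset.image_congr fun R hR => h.ribbonAt_start hn hR).trans Finset.image_id

/-! ### Ribbon tableaux and bead moves -/

theorem mem_ribbonTableaux {n k : ℕ} {β α : YoungDiagram} {T : Finset (Finset (ℕ × ℕ))} :
    T ∈ ribbonTableaux n k β α ↔ IsHorizontalStripTiling n k β α T := by
  simp only [ribbonTableaux, Finset.mem_filter, Finset.mem_powerset, and_iff_right_iff_imp]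
  intro hT R hR
  rw [Finset.mem_powerset, ← hT.union]
  exact Finset.subset_biUnion_of_mem id hR

theorem ribbonCoeff_eq_sum_crossings (q : K) {n : ℕ} (hn : 1 ≤ n) (k : ℕ) {M : ℕ}
    {lam mu : YoungDiagram} (hlam : lam.colLen 0 ≤ M) (hmu : mu.colLen 0 ≤ M) :
    ribbonCoeff q n k mu lam =
      ∑ Y ∈ (beads lam M).powersetCard k with move n (beads lam M) Y = beads mu M,
        (-q) ^ (-(crossings n (beads lam M) Y : ℤ)) := by
  symm
  refine Finset.sum_bij (fun Y _ => Y.image (ribbonAt n (beads lam M) Y)) ?_ ?_ ?_ ?_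
  all_goals simp only [Finset.mem_filter, Finset.mem_powersetCard, mem_ribbonTableaux]
  · rintro Y ⟨⟨hY, rfl⟩, hmove⟩
    exact isHorizontalStripTiling_image_ribbonAt hn hlam hmu hY hmove
  · exact fun Y hY Y' hY' => image_ribbonAt_injective hn hY.1.1 hY'.1.1
  · intro T hT
    obtain ⟨Y, hY, hcard, hmove, himage⟩ := hT.exists_beads hn hlam hmu
    exact ⟨Y, ⟨⟨hY, hcard⟩, hmove⟩, himage⟩
  · exact fun Y hY => by rw [twiceSpin_conjugate_image_ribbonAt hn hY.1.1]

/-! ### Finiteness of the expansions -/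

theorem IsHorizontalStripTiling.card_le {n k : ℕ} {β α : YoungDiagram}
    {T : Finset (Finset (ℕ × ℕ))} (hT : IsHorizontalStripTiling n k β α T) :
    β.card ≤ α.card + k * n := by
  have hskew : (β.cells \ α.cells).card ≤ k * n := by
    rw [← hT.union, ← hT.card]
    refine Finset.card_biUnion_le_card_mul _ _ _ fun R hR => ?_
    obtain ⟨c, -, rfl⟩ := hT.ribbon R hR
    exact Finset.card_image_le.trans (Finset.card_range n).le
  have := Finset.card_le_card_sdiff_add_card (s := β.cells) (t := α.cells)
  rw [YoungDiagram.card, YoungDiagram.card]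
  omega

theorem finite_setOf_card_le (m : ℕ) : {β : YoungDiagram | β.card ≤ m}.Finite := by
  refine Set.Finite.subset (Set.Finite.preimage (f := YoungDiagram.cells)
    (fun β _ β' _ h => YoungDiagram.ext h)
    ((Finset.range m ×ˢ Finset.range m).powerset.finite_toSet)) fun β hβ => ?_
  rw [Set.mem_preimage, Finset.mem_coe, Finset.mem_powerset]
  rintro ⟨i, j⟩ hij
  have hrow : β.rowLen i ≤ β.card := by
    rw [YoungDiagram.rowLen_eq_card]
    exact Finset.card_le_card (Finset.filter_subset _ _)
  have hcol : β.colLen j ≤ β.card := by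
    rw [YoungDiagram.colLen_eq_card]
    exact Finset.card_le_card (Finset.filter_subset _ _)
  rw [Finset.mem_product, Finset.mem_range, Finset.mem_range]
  exact ⟨(YoungDiagram.mem_iff_lt_colLen.1 hij).trans_le (hcol.trans hβ),
    (YoungDiagram.mem_iff_lt_rowLen.1 hij).trans_le (hrow.trans hβ)⟩

theorem finite_setOf_card_transpose_le (m : ℕ) :
    {β : YoungDiagram | β.transpose.card ≤ m}.Finite :=
  (finite_setOf_card_le m).preimage YoungDiagram.transposeOrderIso.injective.injOn

theorem exists_isHorizontalStripTiling {q : K} {n k : ℕ} {lam mu : YoungDiagram}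
    (h : ribbonCoeff q n k mu lam ≠ 0) :
    ∃ T, IsHorizontalStripTiling n k mu.transpose lam.transpose T := by
  obtain ⟨T, hT, -⟩ := Finset.exists_ne_zero_of_sum_ne_zero h
  exact ⟨T, mem_ribbonTableaux.1 hT⟩

theorem finite_support_ribbonCoeff_left (q : K) (n k : ℕ) (lam : YoungDiagram) :
    (Function.support fun mu => ribbonCoeff q n k mu lam).Finite :=
  (finite_setOf_card_transpose_le (lam.transpose.card + k * n)).subset fun _ hmu =>
    (exists_isHorizontalStripTiling hmu).elim fun _ hT => hT.card_le

theorem finite_support_ribbonCoeff_right (q : K) (n k : ℕ) (lam : YoungDiagram) :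
    (Function.support fun nu => ribbonCoeff q n k lam nu).Finite :=
  (finite_setOf_card_transpose_le lam.transpose.card).subset fun _ hnu =>
    (exists_isHorizontalStripTiling hnu).elim fun _ hT => Finset.card_le_card hT.le

/-! ### Order reversals of bead moves -/

/-- The position of the bead `x` after the beads in `Y` have been moved by `c`. -/
def moveBead (c : ℤ) (Y : Finset ℤ) (x : ℤ) : ℤ := if x ∈ Y then x + c else x

/-- The number of pairs of beads of `X` whose order is reversed when the beads in `Y` are moved
by `c`. -/
def reversals (c : ℤ) (X Y : Finset ℤ) : ℕ :=
  ((X ×ˢ X).filter fun p => p.2 < p.1 ∧ moveBead c Y p.1 < moveBead c Y p.2).card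

theorem move_eq_image_moveBead {c : ℤ} {X Y : Finset ℤ} (hY : Y ⊆ X) :
    move c X Y = X.image (moveBead c Y) := by
  rw [← Finset.sdiff_union_of_subset hY, Finset.image_union, move,
    Finset.sdiff_union_of_subset hY]
  congr 1
  · exact (Finset.image_id.symm.trans (Finset.image_congr fun x hx =>
      (if_neg (Finset.mem_sdiff.1 hx).2).symm))
  · exact Finset.image_congr fun x hx => (if_pos hx).symm

theorem crossings_eq_reversals {n : ℕ} {X Y : Finset ℤ} (hY : Y ⊆ X) :
    crossings n X Y = reversals n X Y := by
  unfold crossings reversals moveBead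
  congr 1
  ext ⟨x, y⟩
  simp only [Finset.mem_filter, Finset.mem_product, Finset.mem_sdiff]
  have := @hY y
  split_ifs with hx hy hy <;> simp only [hx, hy, not_true, not_false_iff, and_true, and_false,
    false_and, false_iff, not_and, not_lt] at this ⊢
  · omega
  · omega
  · tauto
  · omega

theorem noninversions_moveBead_comp_bead (c : ℤ) (Y : Finset ℤ) (lam : YoungDiagram) (M : ℕ) :
    noninversions (Finset.range M) (moveBead c Y ∘ bead lam) = reversals c (beads lam M) Y := by
  have hinj := (bead_strictAnti lam).injective
  rw [reversals, beads, ← Finset.prodMap_image_product, Finset.filter_image,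
    Finset.card_image_of_injective _ (hinj.prodMap hinj), noninversions]
  simp only [Prod.map_fst, Prod.map_snd, (bead_strictAnti lam).lt_iff_gt, Function.comp_apply]

theorem moveBead_neg_moveBead {c : ℤ} {X Y : Finset ℤ} (hY : Y ⊆ X)
    (h : (move c X Y).card = X.card) {x : ℤ} (hx : x ∈ X) :
    moveBead (-c) (Y.image (· + c)) (moveBead c Y x) = x := by
  by_cases hxY : x ∈ Y
  · rw [moveBead, moveBead, if_pos hxY, if_pos (Finset.mem_image_of_mem _ hxY),
      add_neg_cancel_right]
  · have hstay := Finset.disjoint_left.1 (disjoint_of_card_move hY h)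
      (Finset.mem_sdiff.2 ⟨hx, hxY⟩)
    rw [moveBead, moveBead, if_neg hxY, if_neg hstay]

theorem move_neg_move {c : ℤ} {X Y : Finset ℤ} (hY : Y ⊆ X)
    (h : (move c X Y).card = X.card) :
    move (-c) (move c X Y) (Y.image (· + c)) = X := by
  rw [move_eq_image_moveBead (X := move c X Y) Finset.subset_union_right, move_eq_image_moveBead hY,
    Finset.image_image]
  exact (Finset.image_congr fun x hx => moveBead_neg_moveBead hY h hx).trans Finset.image_id

theorem reversals_neg_move {c : ℤ} {X Y : Finset ℤ} (hY : Y ⊆ X)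
    (h : (move c X Y).card = X.card) :
    reversals (-c) (move c X Y) (Y.image (· + c)) = reversals c X Y := by
  have hback := fun x (hx : x ∈ X) => moveBead_neg_moveBead hY h hx
  have hinj : Set.InjOn (moveBead c Y) X := fun x hx x' hx' heq => by
    rw [← hback x hx, heq, hback x' hx']
  symm
  refine Finset.card_bij (fun p _ => (moveBead c Y p.2, moveBead c Y p.1)) ?_ ?_ ?_
  all_goals simp only [move_eq_image_moveBead hY, Finset.mem_filter, Finset.mem_product]
  · rintro p ⟨⟨hp₁, hp₂⟩, hlt⟩
    rw [hback _ hp₁, hback _ hp₂]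
    exact ⟨⟨Finset.mem_image_of_mem _ hp₂, Finset.mem_image_of_mem _ hp₁⟩, hlt.symm⟩
  · rintro p ⟨⟨hp₁, hp₂⟩, -⟩ p' ⟨⟨hp₁', hp₂'⟩, -⟩ heq
    exact Prod.ext (hinj hp₁ hp₁' (congrArg Prod.snd heq)) (hinj hp₂ hp₂' (congrArg Prod.fst heq))
  · rintro ⟨x, x'⟩ ⟨⟨hx, hx'⟩, hlt⟩
    obtain ⟨z, hz, rfl⟩ := Finset.mem_image.1 hx
    obtain ⟨z', hz', rfl⟩ := Finset.mem_image.1 hx'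
    rw [hback z hz, hback z' hz'] at hlt
    exact ⟨(z', z), ⟨⟨hz', hz⟩, hlt.symm⟩, rfl⟩

theorem image_add_image_add_neg (c : ℤ) (Y : Finset ℤ) :
    (Y.image (· + c)).image (· + -c) = Y := by
  rw [Finset.image_image]
  exact (Finset.image_congr fun y _ => add_neg_cancel_right y c).trans Finset.image_id

theorem image_add_mem_filter_move {c : ℤ} {k : ℕ} {X X' Y : Finset ℤ} (hX : X'.card = X.card)
    (hY : Y ∈ (X.powersetCard k).filter fun Y => move c X Y = X') :
    Y.image (· + c) ∈ (X'.powersetCard k).filter fun Z => move (-c) X' Z = X := by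
  obtain ⟨hYk, rfl⟩ := Finset.mem_filter.1 hY
  obtain ⟨hYX, hcard⟩ := Finset.mem_powersetCard.1 hYk
  refine Finset.mem_filter.2 ⟨Finset.mem_powersetCard.2 ⟨Finset.subset_union_right, ?_⟩,
    move_neg_move hYX hX⟩
  rw [card_image_add, hcard]

/-- The sum of `(-q)^{-r}` over the ways to turn the first `M` beads of `λ` into those of `μ` by
moving `k` beads by `c`, where `r` is the number of reversals of the move. -/
def moveCoeff (q : K) (c : ℤ) (k M : ℕ) (lam mu : YoungDiagram) : K :=
  ∑ Y ∈ (beads lam M).powersetCard k with move c (beads lam M) Y = beads mu M,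
    (-q) ^ (-(reversals c (beads lam M) Y : ℤ))

theorem ribbonCoeff_eq_moveCoeff (q : K) {n : ℕ} (hn : 1 ≤ n) (k : ℕ) {M : ℕ}
    {lam mu : YoungDiagram} (hlam : lam.colLen 0 ≤ M) (hmu : mu.colLen 0 ≤ M) :
    ribbonCoeff q n k mu lam = moveCoeff q n k M lam mu := by
  rw [ribbonCoeff_eq_sum_crossings q hn k hlam hmu]
  refine Finset.sum_congr rfl fun Y hY => ?_
  rw [crossings_eq_reversals (Finset.mem_powersetCard.1 (Finset.mem_filter.1 hY).1).1]

theorem ribbonCoeff_eq_moveCoeff_neg (q : K) {n : ℕ} (hn : 1 ≤ n) (k : ℕ) {M : ℕ}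
    {lam nu : YoungDiagram} (hlam : lam.colLen 0 ≤ M) (hnu : nu.colLen 0 ≤ M) :
    ribbonCoeff q n k lam nu = moveCoeff q (-n) k M lam nu := by
  rw [ribbonCoeff_eq_moveCoeff q hn k hnu hlam]
  have hcard : (beads lam M).card = (beads nu M).card := by rw [card_beads, card_beads]
  refine Finset.sum_bij' (fun Y _ => Y.image (· + (n : ℤ))) (fun Z _ => Z.image (· + -(n : ℤ)))
    (fun Y hY => image_add_mem_filter_move hcard hY) (fun Z hZ => ?_)
    (fun Y _ => image_add_image_add_neg _ Y) (fun Z _ => ?_) fun Y hY => ?_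
  · simpa only [neg_neg] using image_add_mem_filter_move hcard.symm hZ
  · simpa only [neg_neg] using image_add_image_add_neg (-(n : ℤ)) Z
  · obtain ⟨hY, hmove⟩ := Finset.mem_filter.1 hY
    rw [← reversals_neg_move (Finset.mem_powersetCard.1 hY).1 (by rw [hmove, hcard]), hmove]

/-! ### Straightening of moved beads -/

theorem ket_eq_seqFock (q : K) (n : ℕ) {M : ℕ} {lam : YoungDiagram} (hlam : lam.colLen 0 ≤ M) :
    ket q n lam = seqFock q n M (bead lam) := by
  obtain ⟨d, rfl⟩ := Nat.exists_eq_add_of_le hlam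
  exact (seqFock_add q n (isVacuumFrom_bead le_rfl) d).symm

theorem seqFock_eq_zero_of_le_neg (q : K) {n : ℕ} (hn : 1 ≤ n) {M : ℕ} {J : ℕ → ℤ}
    (hJ : IsVacuumFrom M J) (hclose : ∀ s, IsClose n s J) {i : ℕ} (hi : i < M)
    (hle : J i ≤ -(M : ℤ)) : seqFock q n M J = 0 := by
  have htail : J (-J i).toNat = J i := by
    rw [hJ _ (by omega)]
    omega
  rw [← seqFock_add q n hJ ((-J i).toNat + 1 - M)]
  refine seqFock_eq_zero q hn (by simpa using Set.ordConnected_Iio) subset_rfl (hclose _)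
    fun hinj => ?_
  have := hinj (Finset.mem_coe.2 (Finset.mem_range.2 (by omega)))
    (Finset.mem_coe.2 (Finset.mem_range.2 (by omega))) htail
  omega

theorem isClose_moveBead_comp_bead {ε : ℤ} (hε : ε = 1 ∨ ε = -1) (n : ℕ) (s : Finset ℕ)
    (Y : Finset ℤ) (lam : YoungDiagram) : IsClose n s (moveBead (n * ε) Y ∘ bead lam) := by
  intro i _ j _ hij
  have := bead_strictAnti lam hij
  simp only [moveBead, Function.comp_apply]
  rcases hε with rfl | rfl <;> split_ifs <;> omega

theorem isVacuumFrom_moveBead_comp_bead {c : ℤ} {M : ℕ} {lam : YoungDiagram} {Y : Finset ℤ}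
    (hlam : lam.colLen 0 ≤ M) (hY : Y ⊆ beads lam M) :
    IsVacuumFrom M (moveBead c Y ∘ bead lam) := by
  intro i hi
  have hbead := isVacuumFrom_bead hlam i hi
  rw [Function.comp_apply, moveBead, if_neg, hbead]
  intro hmem
  have := neg_lt_of_mem_beads (hY hmem)
  omega

theorem image_moveBead_comp_bead {c : ℤ} {M : ℕ} {lam : YoungDiagram} {Y : Finset ℤ}
    (hY : Y ⊆ beads lam M) :
    (Finset.range M).image (moveBead c Y ∘ bead lam) = move c (beads lam M) Y := by
  rw [← Finset.image_image, move_eq_image_moveBead hY]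
  rfl

section MoveBead

variable {q : K} {n M : ℕ} {ε : ℤ} {lam mu : YoungDiagram} {Y : Finset ℤ}

theorem seqFock_moveBead_of_eq_beads (hq : q ≠ 0) (hn : 1 ≤ n) (hε : ε = 1 ∨ ε = -1)
    (hY : Y ⊆ beads lam M) (hmu : mu.colLen 0 ≤ M)
    (hmove : move (n * ε) (beads lam M) Y = beads mu M) :
    seqFock q n M (moveBead (n * ε) Y ∘ bead lam) =
      ((-q) ^ (-(reversals (n * ε) (beads lam M) Y : ℤ))) • ket q n mu := by
  rw [ket_eq_seqFock q n hmu, ← noninversions_moveBead_comp_bead]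
  exact seqFock_straighten hq hn (isClose_moveBead_comp_bead hε n _ Y lam)
    ((bead_strictAnti mu).strictAntiOn _) ((image_moveBead_comp_bead hY).trans hmove)

-- Either two beads collide, or a bead ends up in the filled part of the vacuum.
theorem seqFock_moveBead_eq_zero (q : K) (hn : 1 ≤ n) (hε : ε = 1 ∨ ε = -1)
    (hlam : lam.colLen 0 ≤ M) (hY : Y ⊆ beads lam M)
    (hmove : beads (ofBeads (move (n * ε) (beads lam M) Y)) M ≠ move (n * ε) (beads lam M) Y) :
    seqFock q n M (moveBead (n * ε) Y ∘ bead lam) = 0 := by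
  have himage := image_moveBead_comp_bead (c := n * ε) hY
  have hclose := fun s => isClose_moveBead_comp_bead hε n s Y lam
  by_cases hcard : (move (n * ε) (beads lam M) Y).card = M
  · obtain ⟨x, hx, hxM⟩ : ∃ x ∈ move (n * ε) (beads lam M) Y, x ≤ -(M : ℤ) := by
      by_contra! hlow
      have := beads_ofBeads (X := move (n * ε) (beads lam M) Y) (by rwa [hcard])
      rw [hcard] at this
      exact hmove this
    obtain ⟨i, hi, rfl⟩ := Finset.mem_image.1 (himage ▸ hx)
    exact seqFock_eq_zero_of_le_neg q hn (isVacuumFrom_moveBead_comp_bead hlam hY) hclose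
      (Finset.mem_range.1 hi) hxM
  · refine seqFock_eq_zero q hn (by simpa using Set.ordConnected_Iio) subset_rfl (hclose _)
      fun hinj => hcard ?_
    rw [← himage, Finset.card_image_of_injOn hinj, Finset.card_range]

theorem shiftSeq_bead (n : ℕ) (ε : ℤ) (S : Finset ℕ) (lam : YoungDiagram) :
    shiftSeq n ε S (bead lam) = moveBead (n * ε) (S.image (bead lam)) ∘ bead lam := by
  funext i
  simp only [shiftSeq, moveBead, Function.comp_apply,
    Function.Injective.mem_finset_image (bead_strictAnti lam).injective]

theorem esymmFock_bead (q : K) (n k : ℕ) (ε : ℤ) (M : ℕ) (lam : YoungDiagram) :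
    esymmFock q n k ε M (bead lam) =
      ∑ Y ∈ (beads lam M).powersetCard k, seqFock q n M (moveBead (n * ε) Y ∘ bead lam) := by
  have hinj := (bead_strictAnti lam).injective
  refine Finset.sum_bij (fun S _ => S.image (bead lam)) (fun S hS => ?_)
    (fun S _ S' _ h => Finset.image_injective hinj h) (fun Y hY => ?_)
    fun S _ => by rw [shiftSeq_bead]
  · obtain ⟨hS, hcard⟩ := Finset.mem_powersetCard.1 hS
    exact Finset.mem_powersetCard.2
      ⟨Finset.image_subset_image hS, (Finset.card_image_of_injective _ hinj).trans hcard⟩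
  · obtain ⟨hY, hcard⟩ := Finset.mem_powersetCard.1 hY
    obtain ⟨S, hS, rfl⟩ := Finset.subset_image_iff.1 hY
    rw [Finset.card_image_of_injective _ hinj] at hcard
    exact ⟨S, Finset.mem_powersetCard.2 ⟨Finset.coe_subset.1 hS, hcard⟩, rfl⟩

theorem card_move_le (hY : Y ⊆ beads lam M) (c : ℤ) : (move c (beads lam M) Y).card ≤ M := by
  rw [move_eq_image_moveBead hY]
  exact Finset.card_image_le.trans (card_beads lam M).le

theorem ofBeads_beads (hmu : mu.colLen 0 ≤ M) : ofBeads (beads mu M) = mu := by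
  have hbeads := beads_ofBeads (X := beads mu M) fun x hx => by
    rw [card_beads]
    exact neg_lt_of_mem_beads hx
  have hcol := colLen_ofBeads_le (beads mu M)
  rw [card_beads] at hbeads hcol
  exact ext_of_beads_eq hcol hmu hbeads

end MoveBead

/-! ### The action on the vectors `|λ⟩` -/

open Classical in
/-- The partitions read off from the configurations that arise when `k` of the first `M` beads of
`λ` are moved by `c`. -/
def movedShapes (c : ℤ) (k M : ℕ) (lam : YoungDiagram) : Finset YoungDiagram :=
  ((beads lam M).powersetCard k).image fun Y => ofBeads (move c (beads lam M) Y)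

theorem mem_movedShapes {c : ℤ} {k M : ℕ} {lam mu : YoungDiagram} :
    mu ∈ movedShapes c k M lam ↔
      ∃ Y ∈ (beads lam M).powersetCard k, ofBeads (move c (beads lam M) Y) = mu := by
  classical exact Finset.mem_image

theorem colLen_le_of_mem_movedShapes {c : ℤ} {k M : ℕ} {lam mu : YoungDiagram}
    (h : mu ∈ movedShapes c k M lam) : mu.colLen 0 ≤ M := by
  obtain ⟨Y, hY, rfl⟩ := mem_movedShapes.1 h
  exact (colLen_ofBeads_le _).trans (card_move_le (Finset.mem_powersetCard.1 hY).1 c)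

theorem mem_movedShapes_of_moveCoeff_ne_zero {q : K} {c : ℤ} {k M : ℕ} {lam mu : YoungDiagram}
    (hmu : mu.colLen 0 ≤ M) (h : moveCoeff q c k M lam mu ≠ 0) : mu ∈ movedShapes c k M lam := by
  obtain ⟨Y, hY, -⟩ := Finset.exists_ne_zero_of_sum_ne_zero h
  obtain ⟨hYk, hmove⟩ := Finset.mem_filter.1 hY
  exact mem_movedShapes.2 ⟨Y, hYk, by rw [hmove, ofBeads_beads hmu]⟩

theorem esymmFock_bead_eq_sum_moveCoeff {q : K} (hq : q ≠ 0) {n : ℕ} (hn : 1 ≤ n) (k : ℕ) {ε : ℤ}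
    (hε : ε = 1 ∨ ε = -1) {M : ℕ} {lam : YoungDiagram} (hlam : lam.colLen 0 ≤ M) :
    esymmFock q n k ε M (bead lam) =
      ∑ mu ∈ movedShapes (n * ε) k M lam, moveCoeff q (n * ε) k M lam mu • ket q n mu := by
  classical
  rw [esymmFock_bead, ← Finset.sum_fiberwise_of_maps_to
    (g := fun Y => ofBeads (move (n * ε) (beads lam M) Y))
    fun Y hY => mem_movedShapes.2 ⟨Y, hY, rfl⟩]
  refine Finset.sum_congr rfl fun mu hmu => ?_
  have hmuM := colLen_le_of_mem_movedShapes hmu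
  have hfiber (Y : Finset ℤ) (hY : move (n * ε) (beads lam M) Y = beads mu M) :
      ofBeads (move (n * ε) (beads lam M) Y) = mu := by rw [hY, ofBeads_beads hmuM]
  rw [moveCoeff, Finset.sum_smul,
    ← Finset.sum_subset (Finset.monotone_filter_right _ fun Y _ => hfiber Y)]
  · refine Finset.sum_congr rfl fun Y hY => ?_
    obtain ⟨hYk, hmove⟩ := Finset.mem_filter.1 hY
    exact seqFock_moveBead_of_eq_beads hq hn hε (Finset.mem_powersetCard.1 hYk).1 hmuM hmove
  · intro Y hY hYmove
    obtain ⟨hYk, hYmu⟩ := Finset.mem_filter.1 hY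
    refine seqFock_moveBead_eq_zero q hn hε hlam (Finset.mem_powersetCard.1 hYk).1 fun hmove =>
      hYmove (Finset.mem_filter.2 ⟨hYk, ?_⟩)
    rw [← hYmu, hmove]

theorem IsThermodynamicLimit.apply_ket {q : K} (hq : q ≠ 0) {n : ℕ} (hn : 1 ≤ n) {k : ℕ} {ε : ℤ}
    (hε : ε = 1 ∨ ε = -1) {E : FockSpace q n →ₗ[K] FockSpace q n}
    (hE : IsThermodynamicLimit q n (esymmPow K n k ε) E) {lam : YoungDiagram} {a : YoungDiagram → K}
    (hfin : (Function.support a).Finite)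
    (ha : ∀ M mu, lam.colLen 0 ≤ M → mu.colLen 0 ≤ M → a mu = moveCoeff q (n * ε) k M lam mu) :
    E (ket q n lam) = ∑ᶠ mu : YoungDiagram, a mu • ket q n mu := by
  obtain ⟨M, hEM, hlam, hsupp⟩ := ((hE.apply_seqFock (isVacuumFrom_bead le_rfl)).and
    ((Filter.eventually_ge_atTop (lam.colLen 0)).and ((Filter.eventually_all_finite hfin).2
      fun mu _ => Filter.eventually_ge_atTop (mu.colLen 0)))).exists
  have hshapes : Function.support (fun mu => a mu • ket q n mu) ⊆
      movedShapes (n * ε) k M lam := fun mu hmu => by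
    have hne : a mu ≠ 0 := left_ne_zero_of_smul hmu
    exact mem_movedShapes_of_moveCoeff_ne_zero (hsupp mu hne) (ha M mu hlam (hsupp mu hne) ▸ hne)
  rw [ket_eq_seqFock q n le_rfl, hEM, esymmFock_bead_eq_sum_moveCoeff hq hn k hε hlam,
    finsum_eq_sum_of_support_subset _ hshapes]
  exact Finset.sum_congr rfl fun mu hmu => by rw [ha M mu hlam (colLen_le_of_mem_movedShapes hmu)]

theorem esymmY_apply_ket {q : K} (hq : q ≠ 0) {n : ℕ} (hn : 1 ≤ n) {k : ℕ}
    {E : FockSpace q n →ₗ[K] FockSpace q n} (hE : IsThermodynamicLimit q n (esymmY K n k) E)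
    (lam : YoungDiagram) :
    E (ket q n lam) = ∑ᶠ mu : YoungDiagram, ribbonCoeff q n k mu lam • ket q n mu :=
  IsThermodynamicLimit.apply_ket hq hn (Or.inl rfl) hE (finite_support_ribbonCoeff_left q n k lam)
    fun M mu hlam hmu => by
      rw [mul_one]
      exact ribbonCoeff_eq_moveCoeff q hn k hlam hmu

theorem esymmYInv_apply_ket {q : K} (hq : q ≠ 0) {n : ℕ} (hn : 1 ≤ n) {k : ℕ}
    {E : FockSpace q n →ₗ[K] FockSpace q n} (hE : IsThermodynamicLimit q n (esymmYInv K n k) E)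
    (lam : YoungDiagram) :
    E (ket q n lam) = ∑ᶠ nu : YoungDiagram, ribbonCoeff q n k lam nu • ket q n nu :=
  IsThermodynamicLimit.apply_ket hq hn (Or.inr rfl) hE (finite_support_ribbonCoeff_right q n k lam)
    fun M nu hlam hnu => by
      rw [mul_neg_one]
      exact ribbonCoeff_eq_moveCoeff_neg q hn k hlam hnu

end QFock

end

theorem mainTheorem11_general {K : Type*} [Field K] {q : K} (hq : q ≠ 0) {n : ℕ} (hn : 1 ≤ n)
    (k : ℕ) :
    ((∃! U : QFock.FockSpace q n →ₗ[K] QFock.FockSpace q n,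
        QFock.IsThermodynamicLimit q n (QFock.esymmYInv K n k) U) ∧
      ∀ U : QFock.FockSpace q n →ₗ[K] QFock.FockSpace q n,
        QFock.IsThermodynamicLimit q n (QFock.esymmYInv K n k) U →
        ∀ lam : YoungDiagram,
          (Function.support fun nu => QFock.ribbonCoeff q n k lam nu).Finite ∧
          U (QFock.ket q n lam) =
            ∑ᶠ nu : YoungDiagram, QFock.ribbonCoeff q n k lam nu • QFock.ket q n nu) ∧
    ((∃! V : QFock.FockSpace q n →ₗ[K] QFock.FockSpace q n,
        QFock.IsThermodynamicLimit q n (QFock.esymmY K n k) V) ∧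
      ∀ V : QFock.FockSpace q n →ₗ[K] QFock.FockSpace q n,
        QFock.IsThermodynamicLimit q n (QFock.esymmY K n k) V →
        ∀ lam : YoungDiagram,
          (Function.support fun mu => QFock.ribbonCoeff q n k mu lam).Finite ∧
          V (QFock.ket q n lam) =
            ∑ᶠ mu : YoungDiagram, QFock.ribbonCoeff q n k mu lam • QFock.ket q n mu) := by
  obtain ⟨U, hU⟩ := QFock.exists_isThermodynamicLimit_neg_one q hn k
  obtain ⟨V, hV⟩ := QFock.exists_isThermodynamicLimit_one q hn k
  exact ⟨⟨⟨U, hU, fun _ h => h.unique hU⟩, fun _ h lam =>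
      ⟨QFock.finite_support_ribbonCoeff_right q n k lam, QFock.esymmYInv_apply_ket hq hn h lam⟩⟩,
    ⟨V, hV, fun _ h => h.unique hV⟩, fun _ h lam =>
      ⟨QFock.finite_support_ribbonCoeff_left q n k lam, QFock.esymmY_apply_ket hq hn h lam⟩⟩

theorem mainTheorem11 {K : Type*} [Field K] [CharZero K] (q : K) (hq : Transcendental ℚ q)
    (n : ℕ) (hn : 1 ≤ n) (k : ℕ) :
    ((∃! U : QFock.FockSpace q n →ₗ[K] QFock.FockSpace q n,
        QFock.IsThermodynamicLimit q n (QFock.esymmYInv K n k) U) ∧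
      ∀ U : QFock.FockSpace q n →ₗ[K] QFock.FockSpace q n,
        QFock.IsThermodynamicLimit q n (QFock.esymmYInv K n k) U →
        ∀ lam : YoungDiagram,
          (Function.support fun nu => QFock.ribbonCoeff q n k lam nu).Finite ∧
          U (QFock.ket q n lam) =
            ∑ᶠ nu : YoungDiagram, QFock.ribbonCoeff q n k lam nu • QFock.ket q n nu) ∧
    ((∃! V : QFock.FockSpace q n →ₗ[K] QFock.FockSpace q n,
        QFock.IsThermodynamicLimit q n (QFock.esymmY K n k) V) ∧
      ∀ V : QFock.FockSpace q n →ₗ[K] QFock.FockSpace q n,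
        QFock.IsThermodynamicLimit q n (QFock.esymmY K n k) V →
        ∀ lam : YoungDiagram,
          (Function.support fun mu => QFock.ribbonCoeff q n k mu lam).Finite ∧
          V (QFock.ket q n lam) =
            ∑ᶠ mu : YoungDiagram, QFock.ribbonCoeff q n k mu lam • QFock.ket q n mu) :=
  mainTheorem11_general (by rintro rfl; exact hq isAlgebraic_zero) hn k
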